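/- Let $d,m\ge 1$ and let $M_p$ be the set of point measures on $\mathbb R^d\times\{1,\dots,m\}$ (Borel measures with values in $\{0,1,2,\dots\}$ on relatively compact Borel sets), with the vague topology, its Borel $\sigma$-algebra and the translation action $T_t$ of $\mathbb R^d$. For $\lambda\in M_p$ let $\lambda^i$ be its part of colour $i$, regarded as a measure on $\mathbb R^d$. Write $C_R\subset\mathbb R^d$ for the open cube of edge length $R$ centred at $0$, and $\ell$ for Lebesgue measure. Let $\mu$ be a Borel probability measure on $M_p$ such that - there is $r>0$ such that every $\lambda$ in the support $X$ of $\mu$ satisfies $\lambda((a+C_r)\times\{1,\dots,m\})\le 1$ for all $a\in\mathbb R^d$; - $\mu$ is invariant and ergodic under the translation action of $\mathbb R^d$; - for each colour $i$ the intensity $I^{(i)}=\int\lambda^i(C_1)\,d\mu(\lambda)$ is positive. Let $w_1,\dots,w_m$ be pairwise distinct nonzero real numbers, and put $\lambda^w=\sum_i w_i\lambda^i$ and $N^w_f(\lambda)=\int f\,d\lambda^w$. The $w$-weighted Palm measure is the signed measure $$\dot\mu^w(D)=\frac1{\ell(B)}\int_X\sum_{x\in B}\lambda^w(\{x\})\,\mathbf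 1_D(T_{-x}\lambda)\,d\mu(\lambda),$$ which is independent of the choice of the bounded Borel set $B$ with $\ell(B)>0$ (for instance $B=C_1$). Its $w$-weighted first moment is $\dot\mu^w_1(f)=\int N^w_f\,d\dot\mu^w$. Then $\dot\mu^w_1$ has a unique Fourier transform that is a positive measure, that is, there is exactly one locally finite positive Borel measure $\widehat{\dot\mu^w_1}$ on $\mathbb R^d$ that integrates all Schwartz functions and satisfies $\int f\,d\widehat{\dot\mu^w_1}=\dot\mu^w_1(\widehat f)$ for every Schwartz function $f$, where $\widehat f(k)=\int f(x)e^{-2\pi i k\cdot x}\,dx$. This measure, the diffraction, is pure point (carried by a countable set) if and only if the dynamical system $(X,\mu)$ has pure point spectrum, meaning that the linear span of the eigenfunctions is dense in $L^2(X,\mu)$. Here an eigenfunction is a nonzero $f\in L^2(X,\mu)$ for which there is $k\in\mathbb R^d$ such that for every $t\in\mathbb R^d$ one has $f(T_{-t}\lambda)=e^{2\pi i k\cdot t}f(\lambda)$ for $\mu$-almost every $\lambda$. -/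

import Mathlib

open MeasureTheory Set
open scoped ENNReal CompactlySupported SchwartzMap FourierTransform

noncomputable section

namespace PointProc

/-- Euclidean space `ℝ^d`. -/
abbrev Space (d : ℕ) : Type := EuclideanSpace ℝ (Fin d)

/-- The space `ℝ^d × {1, …, m}` of points of `ℝ^d` with one of `m` colours. -/
abbrev ColSpace (d m : ℕ) : Type := Space d × Fin m

/-- Translation of a coloured point by `t`. -/
def colTranslate {d m : ℕ} (t : Space d) (p : ColSpace d m) : ColSpace d m := (t + p.1, p.2)

theorem continuous_colTranslate {d m : ℕ} (t : Space d) :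
    Continuous (colTranslate t : ColSpace d m → ColSpace d m) := by
  unfold colTranslate
  fun_prop

theorem measurable_colTranslate {d m : ℕ} (t : Space d) :
    Measurable (colTranslate t : ColSpace d m → ColSpace d m) :=
  (continuous_colTranslate t).measurable

/-- Translations are homeomorphisms. -/
def colTranslateHomeomorph {d m : ℕ} (t : Space d) : ColSpace d m ≃ₜ ColSpace d m where
  toFun := colTranslate t
  invFun := colTranslate (-t)
  left_inv p := by simp [colTranslate]
  right_inv p := by simp [colTranslate]
  continuous_toFun := continuous_colTranslate t
  continuous_invFun := continuous_colTranslate (-t)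

/-- The set `M_p` of point measures: Borel measures taking values in `ℕ` on all relatively compact
Borel sets (regularity is automatic on this space). -/
@[ext]
structure PointMeasure (d m : ℕ) where
  toMeasure : Measure (ColSpace d m)
  exists_nat : ∀ A : Set (ColSpace d m), MeasurableSet A → IsCompact (closure A) →
    ∃ n : ℕ, toMeasure A = n

variable {d m : ℕ}

/-- The vague topology: the coarsest topology making all `lam ↦ ∫ f d(lam)`, `f` continuous with
compact support, continuous. -/
instance : TopologicalSpace (PointMeasure d m) :=
  TopologicalSpace.induced
    (fun (lam : PointMeasure d m) (f : C_c(ColSpace d m, ℝ)) => ∫ p, f p ∂lam.toMeasure)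
    inferInstance

/-- The Borel σ-algebra of the vague topology. -/
instance : MeasurableSpace (PointMeasure d m) := borel _

instance : BorelSpace (PointMeasure d m) := ⟨rfl⟩

/-- Translation of point measures: `(T_t lam)(A) = lam(-t + A)`. -/
instance : AddAction (Space d) (PointMeasure d m) where
  vadd t lam :=
    { toMeasure := lam.toMeasure.map (colTranslate t)
      exists_nat := by
        intro A hA hc
        obtain ⟨n, hn⟩ := lam.exists_nat (colTranslate t ⁻¹' A) (measurable_colTranslate t hA) (by
          have h := (colTranslateHomeomorph (m := m) t).isCompact_preimage.2 hc
          rw [(colTranslateHomeomorph (m := m) t).preimage_closure] at h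
          exact h)
        exact ⟨n, by rw [Measure.map_apply (measurable_colTranslate t) hA, hn]⟩ }
  zero_vadd lam := by
    apply PointMeasure.ext
    change lam.toMeasure.map (colTranslate 0) = lam.toMeasure
    have h : (colTranslate 0 : ColSpace d m → ColSpace d m) = id := by
      funext p
      simp [colTranslate]
    rw [h, Measure.map_id]
  add_vadd s t lam := by
    apply PointMeasure.ext
    change lam.toMeasure.map (colTranslate (s + t))
      = (lam.toMeasure.map (colTranslate t)).map (colTranslate s)
    rw [Measure.map_map (measurable_colTranslate s) (measurable_colTranslate t)]
    congr 1
    funext p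
    simp [colTranslate, add_assoc]

/-- The part `lam^i` of colour `i` of a point measure, as a measure on `ℝ^d`. -/
def PointMeasure.colour (lam : PointMeasure d m) (i : Fin m) : Measure (Space d) :=
  lam.toMeasure.comap (fun x => (x, i))

/-- The open cube `C_R` of edge length `R` centred at `0`. -/
def cube (d : ℕ) (R : ℝ) : Set (Space d) := {x | ∀ j, |x j| < R / 2}

/-- The point measures `lam` with `lam((a + C_r) × {1, …, m}) ≤ 1` for all `a`; they correspond to
the `r`-uniformly discrete subsets of `ℝ^d × {1, …, m}`. -/
def uniformlyDiscrete (d m : ℕ) (r : ℝ) : Set (PointMeasure d m) :=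
  {lam | ∀ a : Space d, lam.toMeasure (((fun x => a + x) '' cube d r) ×ˢ univ) ≤ 1}

/-- The intensity `I^(i)` of the points of colour `i`: their expected number in the cube `C_1` of
volume one. -/
def intensity (μ : Measure (PointMeasure d m)) (i : Fin m) : ℝ≥0∞ :=
  ∫⁻ lam, lam.colour i (cube d 1) ∂μ

/-- The Palm measure with respect to the points of colour `i`,
`D ↦ ∫ ∑_{x ∈ B} lam^i({x}) 1_D(T_{-x} lam) dμ(lam) / ℓ(B)`, with `B = C_1` of volume one. -/
def palm (μ : Measure (PointMeasure d m)) (i : Fin m) : Measure (PointMeasure d m) :=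
  μ.bind fun lam => ((lam.colour i).restrict (cube d 1)).map fun x : Space d => (-x) +ᵥ lam

/-- The integral of `F` against the `w`-weighted Palm measure, the signed combination
`∑ i, w_i • palm μ i`. -/
def weightedPalmIntegral (μ : Measure (PointMeasure d m)) (w : Fin m → ℝ)
    (F : PointMeasure d m → ℂ) : ℂ :=
  ∑ i, (w i : ℂ) * ∫ lam, F lam ∂(palm μ i)

/-- `N^w_f(lam) = lam^w(f)`, where `lam^w = ∑ j, w_j lam^j`. -/
def weightedCount (w : Fin m → ℝ) (f : Space d → ℂ) (lam : PointMeasure d m) : ℂ :=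
  ∑ j, (w j : ℂ) * ∫ x, f x ∂(lam.colour j)

/-- The `w`-weighted first moment of the `w`-weighted Palm measure (the autocorrelation), as a
functional: `f` is mapped to the integral of `N^w_f` against the weighted Palm measure. -/
def weightedFirstMoment (μ : Measure (PointMeasure d m)) (w : Fin m → ℝ)
    (f : Space d → ℂ) : ℂ :=
  weightedPalmIntegral μ w (weightedCount w f)

/-- The positive measure `ν` on `ℝ^d` is the Fourier transform of the weighted first moment of the
weighted Palm measure: `ν(f) = (weighted first moment)(f̂)` for all rapidly decreasing `f`. -/
structure IsDiffraction (μ : Measure (PointMeasure d m)) (w : Fin m → ℝ)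
    (ν : Measure (Space d)) : Prop where
  locallyFinite : IsLocallyFiniteMeasure ν
  integrable : ∀ f : 𝓢(Space d, ℂ), Integrable f ν
  integral_eq : ∀ f : 𝓢(Space d, ℂ),
    ∫ k, f k ∂ν = weightedFirstMoment μ w (𝓕 (f : Space d → ℂ))

/-- A measure is pure point if it is carried by a countable set. -/
def IsPurePoint (ν : Measure (Space d)) : Prop :=
  ∃ S : Set (Space d), S.Countable ∧ ν Sᶜ = 0

/-- `f` is an eigenfunction: `f ≠ 0` and for some `k`, `T_t f = exp(2πi k⬝t) f` in `L²` for all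
`t`, where `(T_t f)(lam) = f(T_{-t} lam)`. -/
def IsEigenfunction (μ : Measure (PointMeasure d m)) (f : Lp ℂ 2 μ) : Prop :=
  f ≠ 0 ∧ ∃ k : Space d, ∀ t : Space d,
    (fun lam => f ((-t) +ᵥ lam)) =ᵐ[μ]
      fun lam => Complex.exp (2 * Real.pi * Complex.I * (inner ℝ k t : ℝ)) * f lam

/-- The dynamical system of `μ` is pure point: the linear span of the eigenfunctions is dense in
`L²`. The support `X` of `μ` has full measure, so `L²(μ)` is `L²(X, μ)`. -/
def HasPurePointSpectrum (μ : Measure (PointMeasure d m)) : Prop :=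
  Dense (Submodule.span ℂ {f : Lp ℂ 2 μ | IsEigenfunction μ f} : Set (Lp ℂ 2 μ))

end PointProc

end

/-!
The counts `N^w` of the Fourier transforms of Schwartz functions are bounded functions of the point
measure. By Campbell's formula their inner products in `L²(μ)` are the values of the first moment of
the Palm measure on the Fourier transforms of the functions `x ↦ conj (g x) * f x`. So this
functional is positive on squares, hence is given by a measure `ν`, and `f ↦ N^w_f̂` extends to an
isometry of `L²(ν)` into `L²(μ)`. Multiplying `f` with a character translates `f̂`, so the isometry
intertwines multiplication by characters with the Koopman operators. Multiplication by characters
on `L²(ν)` has pure point spectrum exactly when `ν` is pure point, and pure point spectrum passes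
from `L²(μ)` to `L²(ν)`, because the adjoint of the isometry maps eigenvectors to eigenvectors.

Conversely, if `ν` is pure point, then the counts lie in the closed span of the eigenfunctions. The
bounded functions in this span form an algebra which is closed under bounded pointwise limits, so
the sets with indicator function in it form a `σ`-algebra. It contains the events that a small open
set contains a point of colour `i`: by uniform discreteness such a set contains at most one point,
whose colour can be read off the weighted count since the weights are distinct and nonzero. These
events generate all measurable sets up to null sets.
-/

noncomputable section

namespace PointProc

open Filter ProbabilityTheory Topology

section Character

variable {V : Type*} [NormedAddCommGroup V] [InnerProductSpace ℝ V]

/-- The character `x ↦ exp(2πi⟪k, x⟫)` of a Euclidean space, as a complex-valued function. -/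
def character (k x : V) : ℂ := Real.fourierChar (inner ℝ k x)

theorem character_eq_exp (k x : V) :
    character k x = Complex.exp (2 * Real.pi * Complex.I * (inner ℝ k x : ℝ)) := by
  rw [character, Real.fourierChar_apply]
  congr 1
  push_cast
  ring

@[simp]
theorem norm_character (k x : V) : ‖character k x‖ = 1 := Circle.norm_coe _

theorem character_comm (k x : V) : character k x = character x k := by
  rw [character, character, real_inner_comm]

theorem character_add_right (k x y : V) :
    character k (x + y) = character k x * character k y := by
  rw [character, inner_add_right, AddChar.map_add_eq_mul, Circle.coe_mul, character, character]

theorem character_add_left (k l x : V) :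
    character (k + l) x = character k x * character l x := by
  rw [character_comm, character_add_right, character_comm x, character_comm x]

@[simp]
theorem character_zero_left (x : V) : character 0 x = 1 := by simp [character]

@[simp]
theorem character_zero_right (k : V) : character k 0 = 1 := by simp [character]

theorem character_neg_mul_character (k x : V) : character k (-x) * character k x = 1 := by
  rw [← character_add_right, neg_add_cancel, character_zero_right]

theorem continuous_character (k : V) : Continuous (character k) := by
  unfold character
  fun_prop

theorem character_injective : Function.Injective (character : V → V → ℂ) := by
  intro k l h
  have hL : Continuous fun p : V × V => innerₗ V p.1 p.2 := continuous_inner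
  refine BoundedContinuousFunction.ext_of_char_eq Real.continuous_fourierChar
    Real.fourierChar_ne_one hL (fun v hv h0 => hv ?_) fun t => congrFun h t
  exact inner_self_eq_zero.1 (LinearMap.congr_fun h0 v)

end Character

/-! ### Families of unitary operators with pure point spectrum -/

section PurePointSubspace

variable {V : Type*} [NormedAddCommGroup V] [InnerProductSpace ℝ V]
  {H : Type*} [NormedAddCommGroup H] [InnerProductSpace ℂ H]
  {H' : Type*} [NormedAddCommGroup H'] [InnerProductSpace ℂ H']
  {U : V → H ≃ₗᵢ[ℂ] H} {U' : V → H' ≃ₗᵢ[ℂ] H'} {k : V} {x : H}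

/-- The joint eigenvectors, with frequency `k`, of a family of unitary operators indexed by `V`. -/
def jointEigenspace (U : V → H ≃ₗᵢ[ℂ] H) (k : V) : Submodule ℂ H :=
  ⨅ t, Module.End.eigenspace ((U t).toLinearEquiv : H →ₗ[ℂ] H) (character k t)

theorem mem_jointEigenspace : x ∈ jointEigenspace U k ↔ ∀ t, U t x = character k t • x := by
  simp [jointEigenspace, Submodule.mem_iInf]

/-- The closed linear span of the joint eigenvectors of a family of unitary operators. -/
def purePointSubspace (U : V → H ≃ₗᵢ[ℂ] H) : Submodule ℂ H :=
  (⨆ k, jointEigenspace U k).topologicalClosure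

theorem isClosed_purePointSubspace : IsClosed (purePointSubspace U : Set H) :=
  Submodule.isClosed_topologicalClosure _

theorem jointEigenspace_le_purePointSubspace (k : V) :
    jointEigenspace U k ≤ purePointSubspace U :=
  (le_iSup (jointEigenspace U) k).trans (Submodule.le_topologicalClosure _)

theorem map_mem_purePointSubspace {T : H →L[ℂ] H'}
    (hT : ∀ k, ∀ x ∈ jointEigenspace U k, T x ∈ purePointSubspace U')
    (hx : x ∈ purePointSubspace U) : T x ∈ purePointSubspace U' := by
  have h : purePointSubspace U ≤ (purePointSubspace U').comap T.toLinearMap :=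
    Submodule.topologicalClosure_minimal _ (iSup_le hT)
      (isClosed_purePointSubspace.preimage T.continuous)
  exact h hx

theorem apply_mem_purePointSubspace_of_isometry {θ : H →ₗᵢ[ℂ] H'}
    (hθ : ∀ t x, U' t (θ x) = θ (U t x))
    (h : purePointSubspace U = ⊤) (x : H) : θ x ∈ purePointSubspace U' := by
  have hx : x ∈ purePointSubspace U := h ▸ Submodule.mem_top
  refine map_mem_purePointSubspace (T := θ.toContinuousLinearMap) (fun k y hy => ?_) hx
  refine jointEigenspace_le_purePointSubspace k (mem_jointEigenspace.2 fun t => ?_)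
  exact (hθ t y).trans ((congrArg θ (mem_jointEigenspace.1 hy t)).trans (map_smul θ _ y))

theorem purePointSubspace_eq_top_iff [CompleteSpace H] : purePointSubspace U = ⊤ ↔
    ∀ x, (∀ k, ∀ y ∈ jointEigenspace U k, inner ℂ y x = 0) → x = 0 := by
  simp only [purePointSubspace, Submodule.topologicalClosure_eq_top_iff,
    ← Submodule.iInf_orthogonal, Submodule.eq_bot_iff, Submodule.mem_iInf,
    Submodule.mem_orthogonal]

variable [CompleteSpace H] [CompleteSpace H'] {θ : H →ₗᵢ[ℂ] H'}

theorem adjoint_mem_jointEigenspace (hθ : ∀ t x, U' t (θ x) = θ (U t x)) {y : H'}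
    (hy : y ∈ jointEigenspace U' k) :
    θ.toContinuousLinearMap.adjoint y ∈ jointEigenspace U k := by
  refine mem_jointEigenspace.2 fun t => ext_inner_left ℂ fun x => ?_
  calc inner ℂ x (U t (θ.toContinuousLinearMap.adjoint y))
      = inner ℂ ((U t).symm x) (θ.toContinuousLinearMap.adjoint y) := by
        rw [← (U t).inner_map_map ((U t).symm x), (U t).apply_symm_apply]
    _ = inner ℂ (θ ((U t).symm x)) y := ContinuousLinearMap.adjoint_inner_right _ _ _
    _ = inner ℂ (θ x) (U' t y) := by
        rw [← (U' t).inner_map_map, hθ, (U t).apply_symm_apply]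
    _ = inner ℂ (θ x) (character k t • y) := by rw [mem_jointEigenspace.1 hy t]
    _ = inner ℂ x (character k t • θ.toContinuousLinearMap.adjoint y) := by
        rw [inner_smul_right, inner_smul_right, ContinuousLinearMap.adjoint_inner_right]
        rfl

theorem purePointSubspace_eq_top_of_isometry (hθ : ∀ t x, U' t (θ x) = θ (U t x))
    (h : purePointSubspace U' = ⊤) : purePointSubspace U = ⊤ := by
  refine purePointSubspace_eq_top_iff.2 fun x hx => ?_
  refine (map_eq_zero_iff θ θ.injective).1 (purePointSubspace_eq_top_iff.1 h _ fun k y hy => ?_)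
  have hxy := hx k _ (adjoint_mem_jointEigenspace hθ hy)
  rwa [ContinuousLinearMap.adjoint_inner_left] at hxy

end PurePointSubspace

section MulLp

variable {α : Type*} [MeasurableSpace α] {μ : Measure α} {φ ψ : α → ℂ}

/-- Multiplication by an essentially bounded function, as an operator on `L²`. -/
def mulLp (hφ : MemLp φ ∞ μ) : Lp ℂ 2 μ →L[ℂ] Lp ℂ 2 μ :=
  (ContinuousLinearMap.mul ℂ ℂ).holderL μ ∞ 2 2 (hφ.toLp φ)

theorem coeFn_mulLp (hφ : MemLp φ ∞ μ) (u : Lp ℂ 2 μ) : mulLp hφ u =ᵐ[μ] fun x => φ x * u x := by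
  filter_upwards [(ContinuousLinearMap.mul ℂ ℂ).coeFn_holder (r := 2) (hφ.toLp φ) u,
    hφ.coeFn_toLp] with x hx hφx
  exact hx.trans (by rw [hφx, ContinuousLinearMap.mul_apply'])

theorem mulLp_eq_mulLp {f : Lp ℂ 2 μ} {g : Lp ℂ 2 μ} (hf : MemLp f ∞ μ) (hφ : MemLp φ ∞ μ)
    (hg : g =ᵐ[μ] φ) : mulLp hφ f = mulLp hf g := by
  refine Lp.ext ?_
  filter_upwards [coeFn_mulLp hφ f, coeFn_mulLp hf g, hg] with x h₁ h₂ h₃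
  rw [h₁, h₂, h₃, mul_comm]

end MulLp

theorem ae_eq_zero_of_forall_singleton {α E : Type*} [MeasurableSpace α] [Zero E]
    {ν : Measure α} {S : Set α}
    (hS : S.Countable) (hν : ν Sᶜ = 0) {f : α → E} (hf : ∀ k, ν {k} ≠ 0 → f k = 0) :
    f =ᵐ[ν] 0 := by
  have hatoms : ν (⋃ k ∈ {k ∈ S | ν {k} = 0}, {k}) = 0 :=
    (measure_biUnion_null_iff (hS.mono (sep_subset _ _))).2 fun k hk => hk.2
  refine measure_mono_null (fun k hk => ?_) (measure_union_null hν hatoms)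
  by_cases hkS : k ∈ S
  · exact Or.inr (mem_biUnion ⟨hkS, of_not_not fun h => hk (hf k h)⟩ rfl)
  · exact Or.inl hkS

section MulCharacter

variable {V : Type*} [NormedAddCommGroup V] [InnerProductSpace ℝ V] [MeasurableSpace V]
  [BorelSpace V] {ν : Measure V}

theorem memLp_top_character (ν : Measure V) (t : V) : MemLp (fun k => character k t) ∞ ν := by
  have hcont : Continuous fun k => character k t := by
    simpa only [character_comm _ t] using continuous_character t
  exact memLp_top_of_bound hcont.aestronglyMeasurable 1 (ae_of_all _ fun k => by simp)

theorem mulLp_character_neg_mulLp_character (t : V) (u : Lp ℂ 2 ν) :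
    mulLp (memLp_top_character ν (-t)) (mulLp (memLp_top_character ν t) u) = u := by
  refine Lp.ext ?_
  filter_upwards [coeFn_mulLp (memLp_top_character ν (-t)) (mulLp (memLp_top_character ν t) u),
    coeFn_mulLp (memLp_top_character ν t) u] with k h₁ h₂
  rw [h₁, h₂, ← mul_assoc, character_neg_mul_character, one_mul]

theorem norm_mulLp_character (t : V) (u : Lp ℂ 2 ν) :
    ‖mulLp (memLp_top_character ν t) u‖ = ‖u‖ := by
  rw [Lp.norm_def, Lp.norm_def]
  refine congrArg ENNReal.toReal (eLpNorm_congr_norm_ae ?_)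
  filter_upwards [coeFn_mulLp (memLp_top_character ν t) u] with k hk
  rw [hk, norm_mul, norm_character, one_mul]

/-- Multiplication by the character `k ↦ exp(2πi⟪k, t⟫)`, as a unitary operator on `L²`. -/
def mulCharacter (ν : Measure V) (t : V) : Lp ℂ 2 ν ≃ₗᵢ[ℂ] Lp ℂ 2 ν where
  toLinearEquiv := LinearEquiv.ofLinearMap (mulLp (memLp_top_character ν t)).toLinearMap
    (mulLp (memLp_top_character ν (-t))).toLinearMap
    (LinearMap.ext fun u => by simpa using mulLp_character_neg_mulLp_character (-t) u)
    (LinearMap.ext fun u => mulLp_character_neg_mulLp_character t u)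
  norm_map' := norm_mulLp_character t

theorem coeFn_mulCharacter (t : V) (u : Lp ℂ 2 ν) :
    mulCharacter ν t u =ᵐ[ν] fun k => character k t * u k :=
  coeFn_mulLp (memLp_top_character ν t) u

variable [SecondCountableTopology V]

theorem ae_eq_of_mem_jointEigenspace_mulCharacter {k₀ : V} {u : Lp ℂ 2 ν}
    (hu : u ∈ jointEigenspace (mulCharacter ν) k₀) : ∀ᵐ k ∂ν, u k ≠ 0 → k = k₀ := by
  have heigen (t : V) : ∀ᵐ k ∂ν, character k t * u k = character k₀ t * u k := by
    filter_upwards [coeFn_mulCharacter t u, Lp.coeFn_smul (character k₀ t) u] with k h₁ h₂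
    rw [← h₁, mem_jointEigenspace.1 hu t, h₂, Pi.smul_apply, smul_eq_mul]
  have hseq := ae_all_iff.2 fun n => heigen (TopologicalSpace.denseSeq V n)
  filter_upwards [hseq] with k hk hk0
  exact character_injective <| (TopologicalSpace.denseRange_denseSeq V).equalizer
    (continuous_character k) (continuous_character k₀) <| funext fun n =>
      mul_right_cancel₀ hk0 (hk n)

theorem indicatorConstLp_singleton_mem_jointEigenspace {k : V} (hk : ν {k} ≠ ⊤) :
    indicatorConstLp 2 (measurableSet_singleton k) hk (1 : ℂ) ∈
      jointEigenspace (mulCharacter ν) k := by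
  refine mem_jointEigenspace.2 fun t => Lp.ext ?_
  set u := indicatorConstLp 2 (measurableSet_singleton k) hk (1 : ℂ)
  filter_upwards [coeFn_mulCharacter t u, Lp.coeFn_smul (character k t) u,
    indicatorConstLp_coeFn (p := 2) (hs := measurableSet_singleton k) (hμs := hk) (c := (1 : ℂ))]
    with l h₁ h₂ h₃
  rw [h₁, h₂, Pi.smul_apply, h₃, smul_eq_mul]
  rcases eq_or_ne l k with rfl | hl
  · rfl
  · rw [indicator_of_notMem (by simpa using hl), mul_zero, mul_zero]

theorem purePointSubspace_mulCharacter_eq_top [IsLocallyFiniteMeasure ν] {S : Set V}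
    (hS : S.Countable) (hν : ν Sᶜ = 0) : purePointSubspace (mulCharacter ν) = ⊤ := by
  refine purePointSubspace_eq_top_iff.2 fun u hu => ?_
  refine (Lp.eq_zero_iff_ae_eq_zero).2 (ae_eq_zero_of_forall_singleton hS hν fun k hk => ?_)
  have hfin : ν {k} ≠ ⊤ := isCompact_singleton.measure_ne_top
  have huk := hu k _ (indicatorConstLp_singleton_mem_jointEigenspace hfin)
  rw [L2.inner_indicatorConstLp_one (measurableSet_singleton k) hfin, integral_singleton] at huk
  exact (smul_eq_zero.1 huk).resolve_left ((measureReal_eq_zero_iff hfin).not.2 hk)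

theorem measure_eq_zero_of_purePointSubspace_eq_top
    (h : purePointSubspace (mulCharacter ν) = ⊤) {B : Set V} (hB : MeasurableSet B)
    (hfin : ν B ≠ ⊤) (hB0 : ∀ k ∈ B, ν {k} = 0) : ν B = 0 := by
  set F : Lp ℂ 2 ν := indicatorConstLp 2 hB hfin 1
  have hF : F = 0 := by
    refine purePointSubspace_eq_top_iff.1 h F fun k₀ u hu => inner_eq_zero_symm.1 ?_
    rw [L2.inner_indicatorConstLp_one hB hfin u]
    have hne : ∀ᵐ k ∂ν, k ∈ B → k ≠ k₀ := by
      by_cases hk : k₀ ∈ B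
      · filter_upwards [measure_eq_zero_iff_ae_notMem.1 (hB0 k₀ hk)] with k hk _ using hk
      · exact ae_of_all _ fun k hkB hkk => hk (hkk ▸ hkB)
    refine setIntegral_eq_zero_of_ae_eq_zero ?_
    filter_upwards [hne, ae_eq_of_mem_jointEigenspace_mulCharacter hu] with k h₁ h₂ hkB
    exact of_not_not fun h₃ => h₁ hkB (h₂ h₃)
  have hnorm : ‖F‖ = 0 := norm_eq_zero.2 hF
  rw [norm_indicatorConstLp two_ne_zero ENNReal.ofNat_ne_top, norm_one, one_mul] at hnorm
  exact (measureReal_eq_zero_iff hfin).1 <|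
    (Real.rpow_eq_zero measureReal_nonneg (by norm_num)).1 hnorm

theorem exists_countable_of_purePointSubspace_eq_top [IsLocallyFiniteMeasure ν]
    (h : purePointSubspace (mulCharacter ν) = ⊤) : ∃ S : Set V, S.Countable ∧ ν Sᶜ = 0 := by
  have hS : {k | 0 < ν {k}}.Countable :=
    Measure.countable_meas_pos_of_disjoint_iUnion₀
      (fun k => (measurableSet_singleton k).nullMeasurableSet)
      fun k l hkl => (disjoint_singleton.2 hkl).aedisjoint
  refine ⟨{k | 0 < ν {k}}, hS, measure_null_of_locally_null _ fun x _ => ?_⟩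
  obtain ⟨W, hxW, hW, hνW⟩ := ν.exists_isOpen_measure_lt_top x
  refine ⟨{k | 0 < ν {k}}ᶜ ∩ W, inter_mem_nhdsWithin _ (hW.mem_nhds hxW), ?_⟩
  exact measure_eq_zero_of_purePointSubspace_eq_top h
    (hS.measurableSet.compl.inter hW.measurableSet)
    (measure_ne_top_of_subset inter_subset_right hνW.ne) fun k hk => by simpa using hk.1

theorem exists_countable_iff_purePointSubspace_mulCharacter_eq_top [IsLocallyFiniteMeasure ν] :
    (∃ S : Set V, S.Countable ∧ ν Sᶜ = 0) ↔ purePointSubspace (mulCharacter ν) = ⊤ :=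
  ⟨fun ⟨_, hS, hν⟩ => purePointSubspace_mulCharacter_eq_top hS hν,
    exists_countable_of_purePointSubspace_eq_top⟩

end MulCharacter

/-! ### Almost periodic functions of a measure-preserving action -/

section Koopman

variable {V : Type*} [NormedAddCommGroup V] {Ω : Type*} [MeasurableSpace Ω] [AddAction V Ω]
  [MeasurableConstVAdd V Ω] {μ : Measure Ω} [VAddInvariantMeasure V Ω μ] {k l : V} {f : Ω → ℂ}
  {F G : Lp ℂ 2 μ}

variable (V μ) in
/-- The Koopman representation `(T_t f)(ω) = f(-t + ω)` of a measure-preserving action. -/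
def koopman (t : V) : Lp ℂ 2 μ ≃ₗᵢ[ℂ] Lp ℂ 2 μ :=
  .ofSurjective (Lp.compMeasurePreservingₗᵢ ℂ _ (measurePreserving_vadd (-t) μ)) fun f =>
    ⟨Lp.compMeasurePreserving _ (measurePreserving_vadd t μ) f, Lp.ext <| by
      have hf := Lp.coeFn_compMeasurePreserving f (measurePreserving_vadd t μ)
      filter_upwards [Lp.coeFn_compMeasurePreserving (Lp.compMeasurePreserving _
        (measurePreserving_vadd t μ) f) (measurePreserving_vadd (-t) μ),
        (measurePreserving_vadd (-t) μ).quasiMeasurePreserving.ae hf] with ω h₁ h₂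
      exact h₁.trans (h₂.trans (by simp))⟩

theorem coeFn_koopman (t : V) (F : Lp ℂ 2 μ) : koopman V μ t F =ᵐ[μ] fun ω => F (-t +ᵥ ω) :=
  Lp.coeFn_compMeasurePreserving F (measurePreserving_vadd (-t) μ)

theorem koopman_eq_iff (t : V) {g : Ω → ℂ} (hF : F =ᵐ[μ] f) (hG : G =ᵐ[μ] g) :
    koopman V μ t F = G ↔ (fun ω => f (-t +ᵥ ω)) =ᵐ[μ] g := by
  have hFt := (measurePreserving_vadd (-t) μ).quasiMeasurePreserving.ae hF
  have hUF : koopman V μ t F =ᵐ[μ] fun ω => f (-t +ᵥ ω) := (coeFn_koopman t F).trans hFt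
  rw [Lp.ext_iff]
  exact ⟨fun h => hUF.symm.trans (h.trans hG), fun h => hUF.trans (h.trans hG.symm)⟩

variable [InnerProductSpace ℝ V]

theorem mem_jointEigenspace_koopman (hF : F =ᵐ[μ] f) : F ∈ jointEigenspace (koopman V μ) k ↔
    ∀ t : V, (fun ω => f (-t +ᵥ ω)) =ᵐ[μ] fun ω => character k t * f ω :=
  mem_jointEigenspace.trans <| forall_congr' fun t => koopman_eq_iff t hF <|
    (Lp.coeFn_smul _ F).trans (hF.fun_comp (character k t * ·))

theorem mulLp_mem_jointEigenspace_koopman (hF : MemLp F ∞ μ)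
    (hFk : F ∈ jointEigenspace (koopman V μ) k) (hGl : G ∈ jointEigenspace (koopman V μ) l) :
    mulLp hF G ∈ jointEigenspace (koopman V μ) (k + l) := by
  refine (mem_jointEigenspace_koopman (coeFn_mulLp hF G)).2 fun t => ?_
  filter_upwards [(mem_jointEigenspace_koopman (.refl _ F)).1 hFk t,
    (mem_jointEigenspace_koopman (.refl _ G)).1 hGl t] with ω h₁ h₂
  rw [h₁, h₂, character_add_left]
  ring

/- The modulus of an eigenfunction is invariant, so that truncating an eigenfunction where its
modulus is large gives an eigenfunction with the same frequency. -/
theorem mem_closure_memLp_top_of_mem_jointEigenspace_koopman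
    (hF : F ∈ jointEigenspace (koopman V μ) k) :
    F ∈ closure {G : Lp ℂ 2 μ | G ∈ jointEigenspace (koopman V μ) k ∧ MemLp G ∞ μ} := by
  refine EMetric.mem_closure_iff.2 fun ε hε => ?_
  obtain ⟨δ, hδ, hδε⟩ : ∃ δ : ℝ, 0 < δ ∧ ENNReal.ofReal δ < ε := by
    obtain ⟨δ, hδ, hδε⟩ := ENNReal.lt_iff_exists_nnreal_btwn.1 hε
    exact ⟨δ, by exact_mod_cast hδ, by simpa using hδε⟩
  obtain ⟨M, hM, htail⟩ := (Lp.memLp F).eLpNorm_indicator_norm_ge_pos_le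
    (Lp.stronglyMeasurable F) hδ
  set A := {ω | M ≤ ‖F ω‖₊}
  have hA : MeasurableSet Aᶜ :=
    (measurableSet_le measurable_const
      (Lp.stronglyMeasurable F).measurable.nnnorm.coe_nnreal_real).compl
  have hL2 : MemLp (Aᶜ.indicator F) 2 μ := (Lp.memLp F).indicator hA
  have hbdd (ω : Ω) : ‖Aᶜ.indicator F ω‖ ≤ M := by
    by_cases hω : ω ∈ Aᶜ
    · have hlt : ‖F ω‖ < M := not_le.1 hω
      simpa only [indicator_of_mem hω] using hlt.le
    · simpa [hω] using hM.le
  refine ⟨hL2.toLp _, ⟨(mem_jointEigenspace_koopman hL2.coeFn_toLp).2 fun t => ?_, ?_⟩, ?_⟩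
  · filter_upwards [(mem_jointEigenspace_koopman (.refl _ F)).1 hF t] with ω hω
    have hmem : -t +ᵥ ω ∈ Aᶜ ↔ ω ∈ Aᶜ := by simp [A, hω]
    simp only [indicator, hmem, hω, mul_ite, mul_zero]
  · exact (memLp_top_of_bound hL2.1 M (ae_of_all _ hbdd)).ae_eq hL2.coeFn_toLp.symm
  · rw [Lp.edist_def]
    refine (eLpNorm_congr_ae ?_).trans_lt (htail.trans_lt hδε)
    filter_upwards [hL2.coeFn_toLp] with ω hω
    rw [Pi.sub_apply, hω, sub_eq_iff_eq_add, ← Pi.add_apply, indicator_self_add_compl]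

theorem mulLp_mem_purePointSubspace_koopman (hf : MemLp f ∞ μ)
    (hG : G ∈ purePointSubspace (koopman V μ)) (hGf : G =ᵐ[μ] f)
    (hF : F ∈ purePointSubspace (koopman V μ)) :
    mulLp hf F ∈ purePointSubspace (koopman V μ) := by
  refine map_mem_purePointSubspace (fun k E hE => ?_) hF
  have hmaps : MapsTo (mulLp hf) {E | E ∈ jointEigenspace (koopman V μ) k ∧ MemLp E ∞ μ}
      (purePointSubspace (koopman V μ)) := by
    rintro E ⟨hEk, hE⟩
    rw [mulLp_eq_mulLp hE hf hGf]
    exact map_mem_purePointSubspace (fun l D hD => jointEigenspace_le_purePointSubspace _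
      (mulLp_mem_jointEigenspace_koopman hE hEk hD)) hG
  have hclosure := hmaps.closure (mulLp hf).continuous
  rw [isClosed_purePointSubspace.closure_eq] at hclosure
  exact hclosure (mem_closure_memLp_top_of_mem_jointEigenspace_koopman hE)

end Koopman

section AlmostPeriodic

theorem unifIntegrable_of_norm_le {α ι E : Type*} [MeasurableSpace α] {μ : Measure α}
    [NormedAddCommGroup E] {p : ℝ≥0∞} (hp : 1 ≤ p) (hp' : p ≠ ⊤) {f : ι → α → E} {C : ℝ}
    (hf : ∀ i, AEStronglyMeasurable (f i) μ) (hC : ∀ i, ∀ᵐ x ∂μ, ‖f i x‖ ≤ C) :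
    UnifIntegrable f p μ := by
  refine unifIntegrable_of hp hp' hf fun ε hε => ⟨C.toNNReal + 1, fun i => ?_⟩
  have hzero : {x | C.toNNReal + 1 ≤ ‖f i x‖₊}.indicator (f i) =ᵐ[μ] 0 := by
    filter_upwards [hC i] with x hx
    refine indicator_of_notMem (fun hlarge => ?_) _
    have hle : ((C.toNNReal + 1 : NNReal) : ℝ) ≤ ‖f i x‖ := hlarge
    push_cast at hle
    linarith [Real.le_coe_toNNReal C]
  rw [eLpNorm_congr_ae hzero, eLpNorm_zero]
  exact bot_le

variable {V : Type*} [NormedAddCommGroup V] [InnerProductSpace ℝ V]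
  {Ω : Type*} [MeasurableSpace Ω] [AddAction V Ω] [MeasurableConstVAdd V Ω] {μ : Measure Ω}
  [VAddInvariantMeasure V Ω μ] {f g : Ω → ℂ} {A B : Set Ω}

variable (V μ) in
/-- A function is almost periodic for a measure-preserving action if it is essentially bounded and
lies in the closed linear span of the eigenfunctions. Those functions form an algebra. -/
structure IsAlmostPeriodic (f : Ω → ℂ) : Prop where
  memLp_top : MemLp f ∞ μ
  exists_mem : ∃ F ∈ purePointSubspace (koopman V μ), F =ᵐ[μ] f

namespace IsAlmostPeriodic

theorem congr (hf : IsAlmostPeriodic V μ f) (h : f =ᵐ[μ] g) : IsAlmostPeriodic V μ g :=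
  ⟨hf.memLp_top.ae_eq h, hf.exists_mem.imp fun _ hF => ⟨hF.1, hF.2.trans h⟩⟩

theorem add (hf : IsAlmostPeriodic V μ f) (hg : IsAlmostPeriodic V μ g) :
    IsAlmostPeriodic V μ fun ω => f ω + g ω := by
  obtain ⟨F, hF, hFf⟩ := hf.exists_mem
  obtain ⟨G, hG, hGg⟩ := hg.exists_mem
  exact ⟨hf.memLp_top.add hg.memLp_top, F + G, add_mem hF hG,
    (Lp.coeFn_add F G).trans (hFf.add hGg)⟩

theorem const_mul (c : ℂ) (hf : IsAlmostPeriodic V μ f) :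
    IsAlmostPeriodic V μ fun ω => c * f ω := by
  obtain ⟨F, hF, hFf⟩ := hf.exists_mem
  exact ⟨hf.memLp_top.const_mul c, c • F, Submodule.smul_mem _ c hF,
    (Lp.coeFn_smul c F).trans (hFf.const_smul c)⟩

theorem mul (hf : IsAlmostPeriodic V μ f) (hg : IsAlmostPeriodic V μ g) :
    IsAlmostPeriodic V μ fun ω => f ω * g ω := by
  obtain ⟨F, hF, hFf⟩ := hf.exists_mem
  obtain ⟨G, hG, hGg⟩ := hg.exists_mem
  exact ⟨hg.memLp_top.mul' hf.memLp_top, mulLp hf.memLp_top G,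
    mulLp_mem_purePointSubspace_koopman _ hF hFf hG,
    (coeFn_mulLp _ G).trans ((Filter.EventuallyEq.refl _ f).mul hGg)⟩

theorem indicator_union (hA : IsAlmostPeriodic V μ (A.indicator 1))
    (hB : IsAlmostPeriodic V μ (B.indicator 1)) : IsAlmostPeriodic V μ ((A ∪ B).indicator 1) :=
  ((hA.add hB).add ((hA.mul hB).const_mul (-1))).congr <| ae_of_all _ fun ω => by
    by_cases h₁ : ω ∈ A <;> by_cases h₂ : ω ∈ B <;> simp [h₁, h₂]

variable [IsFiniteMeasure μ]

theorem of_tendsto {f : ℕ → Ω → ℂ} {C : ℝ} (hf : ∀ n, IsAlmostPeriodic V μ (f n))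
    (hC : ∀ n, ∀ᵐ ω ∂μ, ‖f n ω‖ ≤ C)
    (hlim : ∀ᵐ ω ∂μ, Tendsto (fun n => f n ω) atTop (𝓝 (g ω))) : IsAlmostPeriodic V μ g := by
  have hgC : ∀ᵐ ω ∂μ, ‖g ω‖ ≤ C := by
    filter_upwards [ae_all_iff.2 hC, hlim] with ω h₁ h₂
    exact le_of_tendsto h₂.norm (Eventually.of_forall h₁)
  have hgm : AEStronglyMeasurable g μ :=
    aestronglyMeasurable_of_tendsto_ae atTop (fun n => (hf n).memLp_top.1) hlim
  have hgL : MemLp g 2 μ := MemLp.of_bound hgm C hgC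
  refine ⟨memLp_top_of_bound hgm C hgC, hgL.toLp g, ?_, hgL.coeFn_toLp⟩
  choose F hF hFf using fun n => (hf n).exists_mem
  refine isClosed_purePointSubspace.mem_of_tendsto (b := atTop) (f := F) ?_
    (Eventually.of_forall hF)
  refine (Lp.tendsto_Lp_iff_tendsto_eLpNorm' F _).2 ?_
  refine tendsto_Lp_finite_of_tendsto_ae one_le_two ENNReal.ofNat_ne_top
    (fun n => Lp.aestronglyMeasurable (F n)) (Lp.memLp _) (unifIntegrable_of_norm_le one_le_two
      ENNReal.ofNat_ne_top (C := C) (fun n => Lp.aestronglyMeasurable (F n)) fun n => ?_) ?_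
  · filter_upwards [hFf n, hC n] with ω h₁ h₂ using h₁ ▸ h₂
  · filter_upwards [ae_all_iff.2 hFf, hlim, hgL.coeFn_toLp] with ω h₁ h₂ h₃
    simpa only [h₁, h₃] using h₂

variable (V μ) in
theorem const (c : ℂ) : IsAlmostPeriodic V μ fun _ => c :=
  ⟨memLp_const c, (memLp_const c).toLp _, jointEigenspace_le_purePointSubspace 0 <|
    (mem_jointEigenspace_koopman (memLp_const c).coeFn_toLp).2 fun _ => by simp,
    (memLp_const c).coeFn_toLp⟩

theorem polynomial_eval (p : Polynomial ℂ) (hf : IsAlmostPeriodic V μ f) :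
    IsAlmostPeriodic V μ fun ω => p.eval (f ω) := by
  induction p using Polynomial.induction_on' with
  | add p q hp hq => simpa only [Polynomial.eval_add] using hp.add hq
  | monomial n c =>
    simp only [Polynomial.eval_monomial]
    refine IsAlmostPeriodic.const_mul c ?_
    induction n with
    | zero => simpa only [pow_zero] using const V μ 1
    | succ n ih => simpa only [pow_succ] using ih.mul hf

theorem indicator_compl (hA : IsAlmostPeriodic V μ (A.indicator 1)) :
    IsAlmostPeriodic V μ (Aᶜ.indicator 1) :=
  ((const V μ 1).add (hA.const_mul (-1))).congr <| ae_of_all _ fun ω => by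
    by_cases h : ω ∈ A <;> simp [h]

theorem indicator_iUnion {A : ℕ → Set Ω} (hA : ∀ n, IsAlmostPeriodic V μ ((A n).indicator 1)) :
    IsAlmostPeriodic V μ ((⋃ n, A n).indicator 1) := by
  have hacc (n : ℕ) : IsAlmostPeriodic V μ ((accumulate A n).indicator 1) := by
    induction n with
    | zero => simpa using hA 0
    | succ n ih => simpa only [accumulate_succ] using ih.indicator_union (hA (n + 1))
  refine of_tendsto (C := 1) hacc (fun n => ae_of_all _ fun ω => ?_) (ae_of_all _ fun ω => ?_)
  · exact (norm_indicator_le_norm_self _ ω).trans (by simp)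
  · rw [← iUnion_accumulate]
    exact (monotone_accumulate.tendsto_indicator _ _ ω).mono_right (pure_le_nhds _)

variable (V μ) in
/-- The `σ`-algebra of the sets with almost periodic indicator function. -/
@[reducible]
def sigmaAlgebra : MeasurableSpace Ω where
  MeasurableSet' A := IsAlmostPeriodic V μ (A.indicator 1)
  measurableSet_empty := by simpa only [indicator_empty] using const V μ 0
  measurableSet_compl _ := indicator_compl
  measurableSet_iUnion _ := indicator_iUnion

theorem measurable_congr {β : Type*} [MeasurableSpace β] {f g : Ω → β}
    (hf : Measurable[sigmaAlgebra V μ] f) (h : f =ᵐ[μ] g) : Measurable[sigmaAlgebra V μ] g :=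
  fun A hA => IsAlmostPeriodic.congr (hf hA) (indicator_ae_eq_of_ae_eq_set (h.preimage A))

end IsAlmostPeriodic

theorem purePointSubspace_koopman_eq_top [IsFiniteMeasure μ]
    (h : ∀ A : Set Ω, MeasurableSet A → IsAlmostPeriodic V μ (A.indicator 1)) :
    purePointSubspace (koopman V μ) = ⊤ := by
  rw [← isClosed_purePointSubspace.submodule_topologicalClosure_eq,
    Submodule.topologicalClosure_eq_top_iff, Submodule.eq_bot_iff]
  intro G hG
  rw [Lp.eq_zero_iff_ae_eq_zero]
  refine Integrable.ae_eq_zero_of_forall_setIntegral_eq_zero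
    ((Lp.memLp G).integrable one_le_two) fun A hA _ => ?_
  obtain ⟨F, hF, hFA⟩ := (h A hA).exists_mem
  have hFeq : F = indicatorConstLp 2 hA (measure_ne_top μ A) (1 : ℂ) :=
    Lp.ext (hFA.trans indicatorConstLp_coeFn.symm)
  have horth := (Submodule.mem_orthogonal _ _).1 hG F hF
  rwa [hFeq, L2.inner_indicatorConstLp_one hA (measure_ne_top μ A) G] at horth

end AlmostPeriodic

/-! ### Measures of temperate growth -/

section Growth

variable {E : Type*} [NormedAddCommGroup E] [NormedSpace ℝ E]

/-- The weight `(1 + ‖x‖)⁻ⁿ` with `n` one more than the dimension, which is integrable and of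
comparable size on any two points at bounded distance. -/
def decayWeight (x : E) : ℝ := (1 + ‖x‖) ^ (-((Module.finrank ℝ E + 1 : ℕ) : ℝ))

theorem decayWeight_pos (x : E) : 0 < decayWeight x := by unfold decayWeight; positivity

theorem continuous_decayWeight : Continuous (decayWeight : E → ℝ) := by
  unfold decayWeight
  exact Continuous.rpow_const (by fun_prop) fun x => Or.inl (by positivity)

theorem decayWeight_le_mul_decayWeight {ε : ℝ} (hε : 0 < ε) {x y : E} (hxy : dist y x < ε) :
    decayWeight x ≤ (1 + ε) ^ (Module.finrank ℝ E + 1) * decayWeight y := by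
  have h : 1 + ‖y‖ ≤ (1 + ε) * (1 + ‖x‖) := by
    rw [dist_eq_norm] at hxy
    nlinarith [norm_le_norm_add_norm_sub' y x, norm_nonneg x]
  simp only [decayWeight, Real.rpow_neg (add_nonneg zero_le_one (norm_nonneg _)), Real.rpow_natCast]
  rw [← div_eq_mul_inv, le_div_iff₀ (by positivity), inv_mul_le_iff₀ (by positivity), ← mul_pow,
    mul_comm (1 + ‖x‖)]
  exact pow_le_pow_left₀ (by positivity) h _

theorem exists_norm_le_mul_decayWeight {F : Type*} [NormedAddCommGroup F] [NormedSpace ℝ F]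
    (f : 𝓢(E, F)) : ∃ B : ℝ, 0 ≤ B ∧ ∀ x, ‖f x‖ ≤ B * decayWeight x := by
  set N := Module.finrank ℝ E + 1
  set S := (Finset.Iic (N, 0)).sup (fun m => SchwartzMap.seminorm ℝ m.1 m.2) f
  refine ⟨2 ^ N * S, by positivity, fun x => ?_⟩
  have h := SchwartzMap.one_add_le_sup_seminorm_apply (𝕜 := ℝ) (m := (N, 0)) le_rfl le_rfl f x
  rw [norm_iteratedFDeriv_zero] at h
  simp only [decayWeight, Real.rpow_neg (add_nonneg zero_le_one (norm_nonneg _)), Real.rpow_natCast]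
  rw [← div_eq_mul_inv, le_div_iff₀ (by positivity), mul_comm]
  exact h

variable [MeasurableSpace E]

theorem lintegral_enorm_le_of_norm_le_mul_decayWeight {F : Type*} [NormedAddCommGroup F]
    {ρ : Measure E} {f : E → F} {B : ℝ} (hB : 0 ≤ B) (hf : ∀ x, ‖f x‖ ≤ B * decayWeight x) :
    ∫⁻ x, ‖f x‖ₑ ∂ρ ≤ ENNReal.ofReal B * ∫⁻ x, ENNReal.ofReal (decayWeight x) ∂ρ := by
  rw [← lintegral_const_mul' _ _ ENNReal.ofReal_ne_top]
  refine lintegral_mono fun x => ?_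
  rw [← ENNReal.ofReal_mul hB, ← ofReal_norm]
  exact ENNReal.ofReal_le_ofReal (hf x)

theorem lintegral_setLIntegral_ball {M : Type*} [PseudoMetricSpace M]
    [SecondCountableTopology M] [MeasurableSpace M] [OpensMeasurableSpace M] (ρ σ : Measure M)
    [SFinite ρ] [SFinite σ] (ε : ℝ) {g : M → ℝ≥0∞} (hg : Measurable g) :
    ∫⁻ x, ∫⁻ y in Metric.ball x ε, g y ∂σ ∂ρ = ∫⁻ y, ρ (Metric.ball y ε) * g y ∂σ := by
  have hS : MeasurableSet {p : M × M | dist p.2 p.1 < ε} :=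
    (isOpen_lt (by fun_prop) continuous_const).measurableSet
  have hm : Measurable fun p : M × M => {p : M × M | dist p.2 p.1 < ε}.indicator (g ∘ Prod.snd) p :=
    (hg.comp measurable_snd).indicator hS
  calc ∫⁻ x, ∫⁻ y in Metric.ball x ε, g y ∂σ ∂ρ
      = ∫⁻ x, ∫⁻ y, {p : M × M | dist p.2 p.1 < ε}.indicator (g ∘ Prod.snd) (x, y) ∂σ ∂ρ := by
        simp_rw [← lintegral_indicator measurableSet_ball]
        rfl
    _ = ∫⁻ y, ∫⁻ x, (Metric.ball y ε).indicator (fun _ => g y) x ∂ρ ∂σ := by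
        rw [lintegral_lintegral_swap hm.aemeasurable]
        simp only [indicator, Metric.mem_ball', mem_ofPred_eq, Function.comp_apply]
    _ = ∫⁻ y, ρ (Metric.ball y ε) * g y ∂σ := by
        simp_rw [lintegral_indicator measurableSet_ball, setLIntegral_const, mul_comm]

variable [BorelSpace E]

theorem measure_ball_mul_decayWeight_le (σ : Measure E) [σ.IsAddHaarMeasure] {ε : ℝ} (hε : 0 < ε)
    (x : E) : σ (Metric.ball 0 ε) * ENNReal.ofReal (decayWeight x) ≤
      ∫⁻ y in Metric.ball x ε, ENNReal.ofReal ((1 + ε) ^ (Module.finrank ℝ E + 1)) *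
        ENNReal.ofReal (decayWeight y) ∂σ := by
  rw [← Measure.addHaar_ball_center σ x, mul_comm, ← setLIntegral_const]
  refine setLIntegral_mono' measurableSet_ball fun y hy => ?_
  rw [← ENNReal.ofReal_mul (by positivity)]
  exact ENNReal.ofReal_le_ofReal (decayWeight_le_mul_decayWeight hε hy)

variable [FiniteDimensional ℝ E]

theorem exists_lintegral_decayWeight_le (E : Type*) [NormedAddCommGroup E] [NormedSpace ℝ E]
    [FiniteDimensional ℝ E] [MeasurableSpace E] [BorelSpace E] {ε : ℝ} (hε : 0 < ε) :
    ∃ C : ℝ≥0∞, C ≠ ∞ ∧ ∀ (ρ : Measure E) [SFinite ρ] (K : ℝ≥0∞),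
      (∀ a, ρ (Metric.ball a ε) ≤ K) → ∫⁻ x, ENNReal.ofReal (decayWeight x) ∂ρ ≤ C * K := by
  let σ : Measure E := Measure.addHaar
  set v := σ (Metric.ball 0 ε)
  have hv0 : v ≠ 0 := (Metric.measure_ball_pos σ 0 hε).ne'
  have hvt : v ≠ ∞ := measure_ball_lt_top.ne
  set c : ℝ≥0∞ := ENNReal.ofReal ((1 + ε) ^ (Module.finrank ℝ E + 1))
  set I : ℝ≥0∞ := ∫⁻ y, ENNReal.ofReal (decayWeight (y : E)) ∂σ
  have hI : I ≠ ∞ := (integrable_one_add_norm (by norm_num)).lintegral_lt_top.ne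
  have hdm : Measurable fun x : E => ENNReal.ofReal (decayWeight x) :=
    continuous_decayWeight.measurable.ennreal_ofReal
  refine ⟨v⁻¹ * (c * I), ENNReal.mul_ne_top (ENNReal.inv_ne_top.2 hv0)
    (ENNReal.mul_ne_top ENNReal.ofReal_ne_top hI), fun ρ _ K hK => ?_⟩
  rw [mul_assoc, ← ENNReal.mul_le_iff_le_inv hv0 hvt]
  calc v * ∫⁻ x, ENNReal.ofReal (decayWeight x) ∂ρ
      = ∫⁻ x, v * ENNReal.ofReal (decayWeight x) ∂ρ := (lintegral_const_mul _ hdm).symm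
    _ ≤ ∫⁻ x, ∫⁻ y in Metric.ball x ε, c * ENNReal.ofReal (decayWeight y) ∂σ ∂ρ :=
        lintegral_mono (measure_ball_mul_decayWeight_le σ hε)
    _ = ∫⁻ y, ρ (Metric.ball y ε) * (c * ENNReal.ofReal (decayWeight y)) ∂σ :=
        lintegral_setLIntegral_ball ρ σ ε (hdm.const_mul c)
    _ ≤ ∫⁻ y, K * (c * ENNReal.ofReal (decayWeight y)) ∂σ := by gcongr; exact hK _
    _ = c * I * K := by
        rw [lintegral_const_mul _ (hdm.const_mul c), lintegral_const_mul _ hdm, mul_comm]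

theorem hasTemperateGrowth_of_ball_le {ρ : Measure E} [SFinite ρ] {ε : ℝ} (hε : 0 < ε)
    {K : ℝ≥0∞} (hK : K ≠ ∞) (h : ∀ a, ρ (Metric.ball a ε) ≤ K) : ρ.HasTemperateGrowth := by
  obtain ⟨C, hC, hρ⟩ := exists_lintegral_decayWeight_le E hε
  refine ⟨⟨Module.finrank ℝ E + 1, continuous_decayWeight.aestronglyMeasurable, ?_⟩⟩
  change HasFiniteIntegral decayWeight ρ
  rw [hasFiniteIntegral_iff_ofReal (ae_of_all _ fun x => (decayWeight_pos x).le)]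
  exact (hρ ρ K h).trans_lt (ENNReal.mul_lt_top hC.lt_top hK.lt_top)

theorem isLocallyFiniteMeasure_of_ball_le {M : Type*} [PseudoMetricSpace M] [MeasurableSpace M]
    {ρ : Measure M} {ε : ℝ} (hε : 0 < ε) {K : ℝ≥0∞} (hK : K ≠ ∞)
    (h : ∀ a, ρ (Metric.ball a ε) ≤ K) : IsLocallyFiniteMeasure ρ :=
  ⟨fun a => ⟨Metric.ball a ε, Metric.ball_mem_nhds a hε, (h a).trans_lt hK.lt_top⟩⟩

end Growth

/-! ### Density of compactly supported functions in Schwartz space -/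

section Truncation

open scoped ContDiff

variable {E : Type*} [NormedAddCommGroup E] [NormedSpace ℝ E]
  {F : Type*} [NormedAddCommGroup F] [NormedSpace ℝ F]

theorem seminorm_le_of_forall_eq_smul {f h : 𝓢(E, F)} {g : E → ℝ} (hg : ContDiff ℝ ∞ g)
    (hfh : ∀ x, h x = g x • f x) {K : ℕ → ℝ}
    (hK : ∀ i x, ‖iteratedFDeriv ℝ i g x‖ ≤ K i * (1 + ‖x‖)) (k l : ℕ) :
    SchwartzMap.seminorm ℝ k l h ≤ ∑ i ∈ Finset.range (l + 1), l.choose i * K i *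
      (SchwartzMap.seminorm ℝ k (l - i) f + SchwartzMap.seminorm ℝ (k + 1) (l - i) f) := by
  have hK0 (i : ℕ) : 0 ≤ K i := by
    have := (norm_nonneg _).trans (hK i 0)
    simpa using this
  refine SchwartzMap.seminorm_le_bound ℝ k l _
    (Finset.sum_nonneg fun i _ => mul_nonneg (mul_nonneg (Nat.cast_nonneg _) (hK0 i))
      (by positivity)) fun x => ?_
  have leibniz := norm_iteratedFDeriv_smul_le hg (f.smooth ⊤) x (n := l) (mod_cast le_top)
  rw [show (h : E → F) = fun x => g x • f x from funext hfh]
  calc _ ≤ ‖x‖ ^ k * ∑ i ∈ Finset.range (l + 1), l.choose i * (K i * (1 + ‖x‖)) *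
        ‖iteratedFDeriv ℝ (l - i) f x‖ := by
        gcongr
        refine leibniz.trans ?_
        gcongr with i
        exact hK i x
    _ = ∑ i ∈ Finset.range (l + 1), l.choose i * K i *
        (‖x‖ ^ k * ‖iteratedFDeriv ℝ (l - i) f x‖ +
          ‖x‖ ^ (k + 1) * ‖iteratedFDeriv ℝ (l - i) f x‖) := by
        rw [Finset.mul_sum]
        exact Finset.sum_congr rfl fun i _ => by ring
    _ ≤ _ := by
        gcongr with i
        · exact mul_nonneg (Nat.cast_nonneg _) (hK0 i)
        · exact SchwartzMap.le_seminorm ℝ k (l - i) f x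
        · exact SchwartzMap.le_seminorm ℝ (k + 1) (l - i) f x

variable [FiniteDimensional ℝ E]

variable (E) in
/-- A smooth bump function, equal to `1` on the unit ball and supported in the ball of radius `2`,
used for cutting off Schwartz functions. -/
def unitBump : ContDiffBump (0 : E) := ⟨1, 2, one_pos, one_lt_two⟩

/-- The bump function at scale `n + 1`, which is `1` on the ball of radius `n + 1`. -/
def scaledBump (n : ℕ) (x : E) : ℝ := unitBump E (((n : ℝ) + 1)⁻¹ • x)

theorem contDiff_scaledBump (n : ℕ) : ContDiff ℝ ∞ (scaledBump n : E → ℝ) :=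
  (unitBump E).contDiff.comp (contDiff_const_smul _)

theorem hasCompactSupport_scaledBump (n : ℕ) : HasCompactSupport (scaledBump n : E → ℝ) :=
  (unitBump E).hasCompactSupport.comp_homeomorph
    (Homeomorph.smulOfNeZero ((n : ℝ) + 1)⁻¹ (by positivity))

theorem norm_scaledBump_sub_one_le (n : ℕ) (x : E) :
    ‖scaledBump n x - 1‖ ≤ (1 + ‖x‖) * ((n : ℝ) + 1)⁻¹ := by
  have hn : 0 < ((n : ℝ) + 1)⁻¹ := by positivity
  by_cases hx : ‖((n : ℝ) + 1)⁻¹ • x‖ ≤ 1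
  · rw [scaledBump, (unitBump E).one_of_mem_closedBall (by simpa [unitBump] using hx), sub_self,
      norm_zero]
    positivity
  · rw [norm_smul, Real.norm_of_nonneg hn.le, not_le] at hx
    have h0 : 0 ≤ scaledBump n x := (unitBump E).nonneg
    have h1 : scaledBump n x ≤ 1 := (unitBump E).le_one
    rw [Real.norm_eq_abs, abs_le]
    constructor <;> nlinarith

theorem exists_norm_iteratedFDeriv_succ_scaledBump_le (E : Type*) [NormedAddCommGroup E]
    [NormedSpace ℝ E] [FiniteDimensional ℝ E] (i : ℕ) : ∃ K : ℝ, ∀ (n : ℕ) (x : E),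
      ‖iteratedFDeriv ℝ (i + 1) (scaledBump n) x‖ ≤ K * ((n : ℝ) + 1)⁻¹ := by
  have hsmooth {k : ℕ∞} : ContDiff ℝ k (unitBump E) := (unitBump E).contDiff
  obtain ⟨K, hK⟩ := (unitBump E).hasCompactSupport.iteratedFDeriv (𝕜 := ℝ) (i + 1)
    |>.exists_bound_of_continuous ((hsmooth (k := ⊤)).continuous_iteratedFDeriv
      (mod_cast le_top))
  refine ⟨K, fun n x => ?_⟩
  have hscale : iteratedFDeriv ℝ (i + 1) (scaledBump n) x =
      (((n : ℝ) + 1)⁻¹) ^ (i + 1) • iteratedFDeriv ℝ (i + 1) (unitBump E) (((n : ℝ) + 1)⁻¹ • x) :=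
    congrFun (iteratedFDeriv_comp_const_smul _ (hsmooth (k := (i + 1 : ℕ)))) x
  rw [hscale, norm_smul, Real.norm_of_nonneg (by positivity), mul_comm]
  have hn : ((n : ℝ) + 1)⁻¹ ≤ 1 := inv_le_one_of_one_le₀ (by linarith [n.cast_nonneg (α := ℝ)])
  have hpow : (((n : ℝ) + 1)⁻¹) ^ (i + 1) ≤ ((n : ℝ) + 1)⁻¹ :=
    pow_le_of_le_one (by positivity) hn i.succ_ne_zero
  exact mul_le_mul (hK _) hpow (by positivity) ((norm_nonneg _).trans (hK x))

theorem exists_norm_iteratedFDeriv_scaledBump_sub_one_le (E : Type*) [NormedAddCommGroup E]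
    [NormedSpace ℝ E] [FiniteDimensional ℝ E] (i : ℕ) : ∃ K : ℝ, ∀ (n : ℕ) (x : E),
      ‖iteratedFDeriv ℝ i (fun x => scaledBump n x - 1) x‖ ≤
        K * ((n : ℝ) + 1)⁻¹ * (1 + ‖x‖) := by
  rcases i with _ | i
  · refine ⟨1, fun n x => ?_⟩
    rw [norm_iteratedFDeriv_zero, one_mul, mul_comm]
    exact norm_scaledBump_sub_one_le n x
  · obtain ⟨K, hK⟩ := exists_norm_iteratedFDeriv_succ_scaledBump_le E i
    refine ⟨K, fun n x => ?_⟩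
    have hconst : iteratedFDeriv ℝ (i + 1) (fun x : E => scaledBump n x - 1) x =
        iteratedFDeriv ℝ (i + 1) (scaledBump n) x := by
      rw [show (fun x : E => scaledBump n x - 1) = scaledBump n - fun _ => (1 : ℝ) from rfl,
        iteratedFDeriv_sub_apply ((contDiff_scaledBump n).contDiffAt.of_le (mod_cast le_top))
          contDiffAt_const, iteratedFDeriv_const_of_ne (by simp)]
      simp
    rw [hconst]
    have h0 : 0 ≤ K * ((n : ℝ) + 1)⁻¹ := (norm_nonneg _).trans (hK n x)
    nlinarith [hK n x, norm_nonneg x]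

/-- A Schwartz function cut off by the bump function at scale `n + 1`. -/
def truncate (n : ℕ) (f : 𝓢(E, F)) : 𝓢(E, F) := SchwartzMap.smulLeftCLM F (scaledBump n) f

theorem truncate_apply (n : ℕ) (f : 𝓢(E, F)) (x : E) : truncate n f x = scaledBump n x • f x :=
  SchwartzMap.smulLeftCLM_apply_apply
    ((hasCompactSupport_scaledBump n).hasTemperateGrowth (contDiff_scaledBump n)) f x

theorem hasCompactSupport_truncate (n : ℕ) (f : 𝓢(E, F)) : HasCompactSupport (truncate n f) := by
  rw [show (truncate n f : E → F) = fun x => scaledBump n x • f x from funext (truncate_apply n f)]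
  exact (hasCompactSupport_scaledBump n).smul_right

theorem tendsto_truncate (f : 𝓢(E, F)) : Tendsto (fun n => truncate n f) atTop (𝓝 f) := by
  rw [(schwartz_withSeminorms ℝ E F).tendsto_nhds]
  rintro ⟨k, l⟩ ε hε
  choose K hK using exists_norm_iteratedFDeriv_scaledBump_sub_one_le E
  have hle (n : ℕ) := seminorm_le_of_forall_eq_smul (f := f) (h := truncate n f - f)
    ((contDiff_scaledBump n).sub contDiff_const)
    (fun x => by rw [sub_smul, one_smul, ← truncate_apply, sub_apply])
    (fun i x => hK i n x) k l
  have hlim : Tendsto (fun n : ℕ => ((n : ℝ) + 1)⁻¹) atTop (𝓝 0) := by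
    simpa only [one_div] using tendsto_one_div_add_atTop_nhds_zero_nat (𝕜 := ℝ)
  have hlim_sum := tendsto_finsetSum (Finset.range (l + 1)) fun i _ =>
    ((hlim.const_mul (K i)).const_mul (l.choose i : ℝ)).mul_const
      (SchwartzMap.seminorm ℝ k (l - i) f + SchwartzMap.seminorm ℝ (k + 1) (l - i) f)
  simp only [mul_zero, zero_mul, Finset.sum_const_zero] at hlim_sum
  filter_upwards [hlim_sum.eventually (gt_mem_nhds hε)] with n hn
  exact (hle n).trans_lt hn

theorem continuousLinearMap_ext_of_hasCompactSupport {𝕜 G : Type*} [NormedField 𝕜]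
    [NormedSpace 𝕜 F] [SMulCommClass ℝ 𝕜 F] [AddCommGroup G] [Module 𝕜 G] [TopologicalSpace G]
    [T2Space G] {Λ₁ Λ₂ : 𝓢(E, F) →L[𝕜] G}
    (h : ∀ f : 𝓢(E, F), HasCompactSupport f → Λ₁ f = Λ₂ f) : Λ₁ = Λ₂ := by
  ext f
  have h₁ := (Λ₁.continuous.tendsto f).comp (tendsto_truncate f)
  have h₂ := (Λ₂.continuous.tendsto f).comp (tendsto_truncate f)
  exact tendsto_nhds_unique h₁ (h₂.congr fun n => (h _ (hasCompactSupport_truncate n f)).symm)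

end Truncation

/-! ### Fourier transforms of translates and products -/

section Fourier

theorem iteratedDeriv_fourierChar (n : ℕ) :
    iteratedDeriv n (fun s : ℝ => (Real.fourierChar s : ℂ)) =
      fun s => (2 * Real.pi * Complex.I) ^ n * Real.fourierChar s := by
  induction n with
  | zero => simp
  | succ n ih =>
    funext s
    rw [iteratedDeriv_succ, ih, deriv_const_mul_field, Real.deriv_fourierChar]
    ring

theorem hasTemperateGrowth_fourierChar :
    (fun s : ℝ => (Real.fourierChar s : ℂ)).HasTemperateGrowth := by
  refine ⟨?_, fun n => ⟨0, ‖(2 * Real.pi * Complex.I : ℂ)‖ ^ n, fun s => ?_⟩⟩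
  · simp only [Real.fourierChar_apply]
    exact ((Complex.ofRealCLM.contDiff.comp (contDiff_const.mul contDiff_id)).mul
      contDiff_const).cexp
  · rw [norm_iteratedFDeriv_eq_norm_iteratedDeriv, iteratedDeriv_fourierChar, norm_mul,
      Circle.norm_coe, norm_pow, pow_zero, mul_one]

theorem hasTemperateGrowth_conj {E : Type*} [NormedAddCommGroup E] [NormedSpace ℝ E]
    (g : 𝓢(E, ℂ)) : (fun x => starRingEnd ℂ (g x)).HasTemperateGrowth :=
  Complex.conjCLE.toContinuousLinearMap.hasTemperateGrowth.comp g.hasTemperateGrowth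

/-- The Schwartz function `x ↦ conj (g x) * f x`. -/
def conjMul {E : Type*} [NormedAddCommGroup E] [NormedSpace ℝ E] (g f : 𝓢(E, ℂ)) : 𝓢(E, ℂ) :=
  SchwartzMap.smulLeftCLM ℂ (fun x => starRingEnd ℂ (g x)) f

@[simp]
theorem conjMul_apply {E : Type*} [NormedAddCommGroup E] [NormedSpace ℝ E] (g f : 𝓢(E, ℂ)) (x : E) :
    conjMul g f x = starRingEnd ℂ (g x) * f x :=
  SchwartzMap.smulLeftCLM_apply_apply (hasTemperateGrowth_conj g) f x

variable {V : Type*} [NormedAddCommGroup V] [InnerProductSpace ℝ V]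

/-- The product of a Schwartz function with the character `x ↦ exp(2πi⟪x, t⟫)`. -/
def modulate (t : V) (f : 𝓢(V, ℂ)) : 𝓢(V, ℂ) :=
  SchwartzMap.smulLeftCLM ℂ (fun x => character x t) f

@[simp]
theorem modulate_apply (t : V) (f : 𝓢(V, ℂ)) (x : V) : modulate t f x = character x t * f x :=
  SchwartzMap.smulLeftCLM_apply_apply
    (hasTemperateGrowth_fourierChar.comp (Function.hasTemperateGrowth_inner_left t)) f x

variable [FiniteDimensional ℝ V] [MeasurableSpace V] [BorelSpace V]

theorem fourier_apply_eq_integral_character (f : 𝓢(V, ℂ)) (a : V) :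
    𝓕 f a = ∫ x, character x (-a) * f x := by
  rw [SchwartzMap.fourier_coe, Real.fourier_eq]
  simp only [character, inner_neg_right, Circle.smul_def, smul_eq_mul]

theorem fourier_modulate (t : V) (f : 𝓢(V, ℂ)) (a : V) : 𝓕 (modulate t f) a = 𝓕 f (a - t) := by
  simp only [fourier_apply_eq_integral_character, modulate_apply, ← mul_assoc,
    ← character_add_right, neg_sub, neg_add_eq_sub]

theorem fourier_compSubConstCLM (k : V) (g : 𝓢(V, ℂ)) (a : V) :
    𝓕 (g.compSubConstCLM ℂ k) a = character k (-a) * 𝓕 g a := by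
  simp only [fourier_apply_eq_integral_character, ← integral_const_mul]
  rw [← integral_add_right_eq_self _ k]
  refine integral_congr_ae (ae_of_all _ fun x => ?_)
  simp only [SchwartzMap.compSubConstCLM_apply, add_sub_cancel_right, character_add_left]
  ring

theorem integral_conj_fourier_mul_fourier (f g : 𝓢(V, ℂ)) (z : V) :
    ∫ a, starRingEnd ℂ (𝓕 g a) * 𝓕 f (a + z) = 𝓕 (conjMul g f) z := by
  have plancherel := SchwartzMap.integral_inner_fourier_fourier g (modulate (-z) f)
  simp only [RCLike.inner_apply', fourier_modulate, sub_neg_eq_add] at plancherel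
  rw [plancherel, fourier_apply_eq_integral_character]
  refine integral_congr_ae (ae_of_all _ fun x => ?_)
  simp only [modulate_apply, conjMul_apply]
  ring

end Fourier

/-! ### The Bochner–Schwartz theorem -/

section BochnerSchwartz

open scoped ContDiff ComplexOrder

variable {E : Type*} [NormedAddCommGroup E] [NormedSpace ℝ E]

variable (E) in
/-- The smooth functions among the continuous functions with compact support. -/
def smoothCompact : Submodule ℝ C_c(E, ℝ) where
  carrier := {f | ContDiff ℝ ∞ f}
  add_mem' {f g} hf hg := by
    change ContDiff ℝ ∞ fun x => f x + g x
    exact ContDiff.add hf hg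
  zero_mem' := show ContDiff ℝ ∞ fun _ : E => (0 : ℝ) from contDiff_const
  smul_mem' c f hf := by
    change ContDiff ℝ ∞ fun x => c * f x
    exact contDiff_const.mul hf

/-- A smooth function with compact support as an element of `smoothCompact`. -/
def mkSmoothCompact (f : E → ℝ) (hf : ContDiff ℝ ∞ f) (hc : HasCompactSupport f) :
    smoothCompact E := ⟨⟨⟨f, hf.continuous⟩, hc⟩, hf⟩

/-- A smooth real function with compact support as a complex Schwartz function. -/
def toSchwartz : smoothCompact E →ₗ[ℝ] 𝓢(E, ℂ) where
  toFun f := HasCompactSupport.toSchwartzMap (f := fun x => (f.1 x : ℂ))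
    (f.1.hasCompactSupport.comp_left Complex.ofReal_zero)
    (Complex.ofRealCLM.contDiff.comp (show ContDiff ℝ ∞ f.1 from f.2))
  map_add' f g := by
    ext x
    exact Complex.ofReal_add (f.1 x) (g.1 x)
  map_smul' c f := by
    ext x
    exact Complex.ofReal_mul c (f.1 x)

theorem integral_toSchwartz [MeasurableSpace E] (ν : Measure E) (u : smoothCompact E) :
    ∫ x, toSchwartz u x ∂ν = ((∫ x, u.1 x ∂ν : ℝ) : ℂ) := integral_ofReal

theorem continuousLinearMap_ext_of_smoothCompact [FiniteDimensional ℝ E]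
    {Λ₁ Λ₂ : 𝓢(E, ℂ) →L[ℂ] ℂ}
    (h : ∀ u : smoothCompact E, Λ₁ (toSchwartz u) = Λ₂ (toSchwartz u)) : Λ₁ = Λ₂ := by
  refine continuousLinearMap_ext_of_hasCompactSupport fun f hf => ?_
  let u : smoothCompact E := mkSmoothCompact (fun x => (f x).re)
    (Complex.reCLM.contDiff.comp (f.smooth ⊤)) (hf.comp_left Complex.zero_re)
  let v : smoothCompact E := mkSmoothCompact (fun x => (f x).im)
    (Complex.imCLM.contDiff.comp (f.smooth ⊤)) (hf.comp_left Complex.zero_im)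
  have hfuv : f = toSchwartz u + Complex.I • toSchwartz v := by
    ext x
    change f x = ((f x).re : ℂ) + Complex.I * ((f x).im : ℂ)
    rw [mul_comm, Complex.re_add_im]
  rw [hfuv, map_add, map_add, map_smul, map_smul, h, h]

/-- A functional on Schwartz functions is positive definite if it is nonnegative on the functions
`|g|²`; this is positivity on the Fourier side. -/
def IsPositiveOnSquares (Λ : 𝓢(E, ℂ) →L[ℂ] ℂ) : Prop := ∀ g : 𝓢(E, ℂ), 0 ≤ Λ (conjMul g g)

section FiniteDimensional

variable [FiniteDimensional ℝ E]

theorem exists_smoothCompact_eq_one {K : Set E} (hK : IsCompact K) :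
    ∃ χ : smoothCompact E, (∀ x ∈ K, χ.1 x = 1) ∧ ∀ x, 0 ≤ χ.1 x := by
  obtain ⟨R, hR⟩ := hK.isBounded.subset_closedBall (0 : E)
  let b : ContDiffBump (0 : E) := ⟨max R 1, max R 1 + 1, by positivity, by linarith⟩
  refine ⟨mkSmoothCompact b b.contDiff b.hasCompactSupport, fun x hx => ?_, fun x => b.nonneg⟩
  exact b.one_of_mem_closedBall (Metric.closedBall_subset_closedBall (le_max_left _ _) (hR hx))

/-- A nonnegative smooth function `f` need not have a smooth square root, but `f + ε χ²` does if
`χ = 1` on the support of `f`. -/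
theorem exists_forall_exists_toSchwartz_eq_conjMul (f : smoothCompact E) (hf : ∀ x, 0 ≤ f.1 x) :
    ∃ q : smoothCompact E, ∀ ε : ℝ, 0 < ε →
      ∃ g : 𝓢(E, ℂ), toSchwartz (f + ε • q) = conjMul g g := by
  obtain ⟨χ, hχ, -⟩ := exists_smoothCompact_eq_one f.1.hasCompactSupport.isCompact
  have hχs : ContDiff ℝ ∞ χ.1 := χ.2
  refine ⟨mkSmoothCompact (fun x => χ.1 x * χ.1 x) (hχs.mul hχs) χ.1.hasCompactSupport.mul_right,
    fun ε hε => ?_⟩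
  have hpos (x : E) : 0 < f.1 x + ε := add_pos_of_nonneg_of_pos (hf x) hε
  let g : smoothCompact E := mkSmoothCompact (fun x => χ.1 x * √(f.1 x + ε))
    (hχs.mul (((show ContDiff ℝ ∞ f.1 from f.2).add contDiff_const).sqrt fun x => (hpos x).ne'))
    χ.1.hasCompactSupport.mul_right
  refine ⟨toSchwartz g, ?_⟩
  ext x
  rw [conjMul_apply]
  change ((f.1 x + ε * (χ.1 x * χ.1 x) : ℝ) : ℂ) =
    starRingEnd ℂ ((χ.1 x * √(f.1 x + ε) : ℝ) : ℂ) * ((χ.1 x * √(f.1 x + ε) : ℝ) : ℂ)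
  rw [Complex.conj_ofReal, ← Complex.ofReal_mul, mul_mul_mul_comm, Real.mul_self_sqrt (hpos x).le]
  by_cases hx : x ∈ tsupport f.1
  · rw [hχ x hx]
    simp
  · rw [image_eq_zero_of_notMem_tsupport hx, zero_add, zero_add, mul_comm]

theorem IsPositiveOnSquares.nonneg {Λ : 𝓢(E, ℂ) →L[ℂ] ℂ} (hΛ : IsPositiveOnSquares Λ)
    (f : smoothCompact E) (hf : ∀ x, 0 ≤ f.1 x) : 0 ≤ Λ (toSchwartz f) := by
  obtain ⟨q, hq⟩ := exists_forall_exists_toSchwartz_eq_conjMul f hf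
  have hlim : Tendsto (fun ε : ℝ => Λ (toSchwartz f + ε • toSchwartz q)) (𝓝[>] 0)
      (𝓝 (Λ (toSchwartz f))) := by
    have hcont : Continuous fun ε : ℝ => Λ (toSchwartz f + ε • toSchwartz q) := by fun_prop
    simpa using (hcont.tendsto 0).mono_left nhdsWithin_le_nhds
  refine ge_of_tendsto hlim (eventually_nhdsWithin_of_forall fun ε hε => ?_)
  obtain ⟨g, hg⟩ := hq ε hε
  rw [← map_smul, ← map_add, hg]
  exact hΛ g

theorem exists_smoothCompact_add_nonneg (f : C_c(E, ℝ)) :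
    ∃ φ : smoothCompact E, (∀ x, 0 ≤ φ.1 x) ∧ 0 ≤ φ.1 + f := by
  obtain ⟨χ, hχ, hχ0⟩ := exists_smoothCompact_eq_one f.hasCompactSupport.isCompact
  obtain ⟨M, hM⟩ := f.hasCompactSupport.exists_bound_of_continuous f.continuous
  have hM0 : 0 ≤ M := (norm_nonneg _).trans (hM 0)
  refine ⟨M • χ, fun x => mul_nonneg hM0 (hχ0 x), fun x => ?_⟩
  change 0 ≤ M * χ.1 x + f x
  by_cases hx : x ∈ tsupport f
  · rw [hχ x hx]
    linarith [neg_abs_le (f x), Real.norm_eq_abs (f x) ▸ hM x]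
  · rw [image_eq_zero_of_notMem_tsupport hx, add_zero]
    exact mul_nonneg hM0 (hχ0 x)

theorem IsPositiveOnSquares.im_eq_zero {Λ : 𝓢(E, ℂ) →L[ℂ] ℂ} (hΛ : IsPositiveOnSquares Λ)
    (f : smoothCompact E) : (Λ (toSchwartz f)).im = 0 := by
  obtain ⟨φ, hφ, hφf⟩ := exists_smoothCompact_add_nonneg f.1
  have hφ_im := (Complex.nonneg_iff.1 (hΛ.nonneg φ hφ)).2
  have hadd_im := (Complex.nonneg_iff.1 (hΛ.nonneg (φ + f) hφf)).2
  rw [map_add, map_add, Complex.add_im, ← hφ_im, zero_add] at hadd_im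
  exact hadd_im.symm

variable [MeasurableSpace E] [BorelSpace E]

theorem IsPositiveOnSquares.exists_measure {Λ : 𝓢(E, ℂ) →L[ℂ] ℂ} (hΛ : IsPositiveOnSquares Λ) :
    ∃ ν : Measure E, IsLocallyFiniteMeasure ν ∧
      ∀ f : smoothCompact E, Λ (toSchwartz f) = ((∫ x, f.1 x ∂ν : ℝ) : ℂ) := by
  let F : C_c(E, ℝ) →ₗ.[ℝ] ℝ := ⟨smoothCompact E, Complex.reLm.comp
    ((Λ.toLinearMap.restrictScalars ℝ).comp toSchwartz)⟩
  have : PosSMulMono ℝ C_c(E, ℝ) := ⟨fun c hc _ _ hfg x => mul_le_mul_of_nonneg_left (hfg x) hc⟩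
  obtain ⟨G, hGF, hG⟩ := riesz_extension (PointedCone.positive ℝ C_c(E, ℝ)) F
    (fun f hf => (Complex.nonneg_iff.1 (hΛ.nonneg f hf)).1)
    (fun f => (exists_smoothCompact_add_nonneg f).imp fun _ h => h.2)
  refine ⟨RealRMK.rieszMeasure (PositiveLinearMap.mk₀ G hG), inferInstance, fun f => ?_⟩
  rw [RealRMK.integral_rieszMeasure]
  exact Complex.ext (hGF f).symm (hΛ.im_eq_zero f)

theorem measure_ball_le_integral_unitBump_sq (ν : Measure E) [IsLocallyFiniteMeasure ν] (a : E) :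
    ν (Metric.ball a 1) ≤
      ENNReal.ofReal (∫ x, unitBump E (x - a) * unitBump E (x - a) ∂ν) := by
  have hc : HasCompactSupport fun x => unitBump E (x - a) :=
    (unitBump E).hasCompactSupport.comp_homeomorph (Homeomorph.subRight a)
  have hint : Integrable (fun x => unitBump E (x - a) * unitBump E (x - a)) ν :=
    Continuous.integrable_of_hasCompactSupport
      (by have := (unitBump E).continuous; fun_prop) hc.mul_right
  rw [ofReal_integral_eq_lintegral_ofReal hint (ae_of_all _ fun _ => mul_self_nonneg _)]
  calc ν (Metric.ball a 1) = ∫⁻ _ in Metric.ball a 1, 1 ∂ν := by simp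
    _ ≤ ∫⁻ x in Metric.ball a 1,
        ENNReal.ofReal (unitBump E (x - a) * unitBump E (x - a)) ∂ν := by
        refine setLIntegral_mono' measurableSet_ball fun _ hx => ?_
        rw [(unitBump E).one_of_mem_closedBall]
        · simp
        · simpa [unitBump, dist_eq_norm] using (Metric.mem_ball.1 hx).le
    _ ≤ _ := setLIntegral_le_lintegral _ _

theorem exists_measure_ball_le_of_bounded_translates {Λ : 𝓢(E, ℂ) →L[ℂ] ℂ} {ν : Measure E}
    [IsLocallyFiniteMeasure ν]
    (hν : ∀ f : smoothCompact E, Λ (toSchwartz f) = ((∫ x, f.1 x ∂ν : ℝ) : ℂ))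
    (hb : ∀ g : 𝓢(E, ℂ), ∃ C : ℝ, ∀ k,
      ‖Λ (conjMul (g.compSubConstCLM ℂ k) (g.compSubConstCLM ℂ k))‖ ≤ C) :
    ∃ K : ℝ≥0∞, K ≠ ⊤ ∧ ∀ a, ν (Metric.ball a 1) ≤ K := by
  obtain ⟨C, hC⟩ := hb
    (toSchwartz (mkSmoothCompact (unitBump E) (unitBump E).contDiff (unitBump E).hasCompactSupport))
  refine ⟨ENNReal.ofReal C, ENNReal.ofReal_ne_top, fun a => ?_⟩
  refine (measure_ball_le_integral_unitBump_sq ν a).trans (ENNReal.ofReal_le_ofReal ?_)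
  have hsmooth : ContDiff ℝ ∞ fun x => unitBump E (x - a) :=
    (unitBump E).contDiff.comp (contDiff_id.sub contDiff_const)
  have hcompact : HasCompactSupport fun x => unitBump E (x - a) :=
    (unitBump E).hasCompactSupport.comp_homeomorph (Homeomorph.subRight a)
  let h : smoothCompact E := mkSmoothCompact (fun x => unitBump E (x - a) * unitBump E (x - a))
    (hsmooth.mul hsmooth) hcompact.mul_right
  have hnorm : ‖Λ (toSchwartz h)‖ ≤ C := by
    convert hC a using 3
    ext x
    rw [conjMul_apply]
    change ((unitBump E (x - a) * unitBump E (x - a) : ℝ) : ℂ) =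
      starRingEnd ℂ (unitBump E (x - a) : ℂ) * (unitBump E (x - a) : ℂ)
    rw [Complex.conj_ofReal, Complex.ofReal_mul]
  rw [hν, Complex.norm_real] at hnorm
  exact (le_abs_self _).trans hnorm

/-- A positive measure that represents `Λ` on compactly supported functions need not be tempered;
the uniform bound on the squares of translates ensures it. -/
theorem IsPositiveOnSquares.exists_hasTemperateGrowth_measure {Λ : 𝓢(E, ℂ) →L[ℂ] ℂ}
    (hΛ : IsPositiveOnSquares Λ) (hb : ∀ g : 𝓢(E, ℂ), ∃ C : ℝ, ∀ k,
      ‖Λ (conjMul (g.compSubConstCLM ℂ k) (g.compSubConstCLM ℂ k))‖ ≤ C) :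
    ∃ ν : Measure E, IsLocallyFiniteMeasure ν ∧ ν.HasTemperateGrowth ∧
      ∀ f : 𝓢(E, ℂ), ∫ x, f x ∂ν = Λ f := by
  obtain ⟨ν, hν, hΛν⟩ := hΛ.exists_measure
  obtain ⟨K, hK, hball⟩ := exists_measure_ball_le_of_bounded_translates hΛν hb
  have hgrowth : ν.HasTemperateGrowth := hasTemperateGrowth_of_ball_le one_pos hK hball
  have heq : SchwartzMap.integralCLM ℂ ν = Λ := continuousLinearMap_ext_of_smoothCompact fun u => by
    rw [SchwartzMap.integralCLM_apply, hΛν, integral_toSchwartz]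
  exact ⟨ν, hν, hgrowth, fun f => by rw [← heq, SchwartzMap.integralCLM_apply]⟩

theorem exists_smoothCompact_lintegral_enorm_sub_le (ρ : Measure E) [IsFiniteMeasureOnCompacts ρ]
    (f : C_c(E, ℝ)) {ε : ℝ} (hε : 0 < ε) :
    ∃ g : smoothCompact E, ∫⁻ x, ‖f x - g.1 x‖ₑ ∂ρ ≤ ENNReal.ofReal ε := by
  obtain ⟨g, hgc, hgs, hg⟩ := HasCompactSupport.exist_eLpNorm_sub_le_of_continuous ρ
    (p := 1) (ε := ε) hε f.hasCompactSupport f.continuous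
  exact ⟨mkSmoothCompact g hgs hgc, by rwa [eLpNorm_one_eq_lintegral_enorm] at hg⟩

theorem ext_of_integral_schwartz {ν₁ ν₂ : Measure E} [IsLocallyFiniteMeasure ν₁]
    [IsLocallyFiniteMeasure ν₂] (h : ∀ f : 𝓢(E, ℂ), ∫ x, f x ∂ν₁ = ∫ x, f x ∂ν₂) : ν₁ = ν₂ := by
  refine Measure.ext_of_integral_eq_on_compactlySupported fun f => ?_
  have : IsFiniteMeasureOnCompacts (ν₁ + ν₂) := ⟨fun K hK => by
    rw [Measure.add_apply]
    exact ENNReal.add_lt_top.2 ⟨hK.measure_lt_top, hK.measure_lt_top⟩⟩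
  refine eq_of_abs_sub_le_all fun ε hε => ?_
  obtain ⟨g, hg⟩ := exists_smoothCompact_lintegral_enorm_sub_le (ν₁ + ν₂) f (half_pos hε)
  have hint (ν : Measure E) [IsLocallyFiniteMeasure ν] (u : C_c(E, ℝ)) : Integrable u ν :=
    u.continuous.integrable_of_hasCompactSupport u.hasCompactSupport
  have hclose (ν : Measure E) [IsLocallyFiniteMeasure ν] (hν : ν ≤ ν₁ + ν₂) :
      |∫ x, f x ∂ν - ∫ x, g.1 x ∂ν| ≤ ε / 2 := by
    rw [← integral_sub (hint ν f) (hint ν g.1), ← Real.norm_eq_abs]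
    have hle := (enorm_integral_le_lintegral_enorm (μ := ν) fun x => f x - g.1 x).trans
      ((lintegral_mono' hν le_rfl).trans hg)
    simpa [ENNReal.toReal_ofReal (half_pos hε).le] using
      ENNReal.toReal_mono ENNReal.ofReal_ne_top hle
  have hg₁₂ : ∫ x, g.1 x ∂ν₁ = ∫ x, g.1 x ∂ν₂ := by
    have := h (toSchwartz g)
    rw [integral_toSchwartz, integral_toSchwartz] at this
    exact_mod_cast this
  have h₁ := abs_le.1 (hclose ν₁ (Measure.le_add_right le_rfl))
  have h₂ := abs_le.1 (hclose ν₂ (Measure.le_add_left le_rfl))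
  rw [hg₁₂] at h₁
  exact abs_le.2 ⟨by linarith, by linarith⟩

end FiniteDimensional

end BochnerSchwartz

/-! ### The vague topology -/

section Vague

variable {X : Type*} [TopologicalSpace X]

theorem exists_denseSeq_near [LocallyCompactSpace X] [SecondCountableTopology X] (f : C(X, ℝ))
    {K : Set X} (hK : IsCompact K) {ε : ℝ} (hε : 0 < ε) :
    ∃ j, ∀ p ∈ K, |f p - TopologicalSpace.denseSeq C(X, ℝ) j p| < ε := by
  have hnhds : {q : C(X, ℝ) | ∀ p ∈ K, |f p - q p| < ε} ∈ 𝓝 f :=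
    Metric.tendstoUniformlyOn_iff.1
      (ContinuousMap.tendsto_iff_forall_isCompact_tendstoUniformlyOn.1 tendsto_id K hK) ε hε
  obtain ⟨_, ⟨j, rfl⟩, hj⟩ :=
    (TopologicalSpace.denseRange_denseSeq C(X, ℝ)).inter_nhds_nonempty hnhds
  exact ⟨j, hj⟩

theorem abs_integral_sub_integral_lt [MeasurableSpace X] [BorelSpace X] (ν : Measure X)
    [IsFiniteMeasureOnCompacts ν] {f g h : C_c(X, ℝ)} {ε M : ℝ} (hε : 0 < ε) (hM : 0 < M)
    (hfg : ∀ p, |f p - g p| ≤ ε / (2 * M) * h p) (hν : ∫ p, h p ∂ν < M) :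
    |∫ p, f p ∂ν - ∫ p, g p ∂ν| < ε := by
  have hint (u : C_c(X, ℝ)) : Integrable u ν :=
    u.continuous.integrable_of_hasCompactSupport u.hasCompactSupport
  calc |∫ p, f p ∂ν - ∫ p, g p ∂ν|
      = |∫ p, (f p - g p) ∂ν| := by rw [integral_sub (hint f) (hint g)]
    _ ≤ ∫ p, |f p - g p| ∂ν := abs_integral_le_integral_abs
    _ ≤ ∫ p, ε / (2 * M) * h p ∂ν :=
        integral_mono ((hint f).sub (hint g)).abs ((hint h).const_mul _) hfg
    _ = ε / (2 * M) * ∫ p, h p ∂ν := integral_const_mul _ _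
    _ ≤ ε / (2 * M) * M := by gcongr
    _ < ε := by field_simp; linarith

variable [T2Space X] [LocallyCompactSpace X] [SecondCountableTopology X]

variable (X) in
theorem exists_cutoff (n : ℕ) : ∃ g : C_c(X, ℝ),
    (∀ p ∈ CompactExhaustion.choice X n, g p = 1) ∧ ∀ p, 0 ≤ g p := by
  obtain ⟨f, hf, -, hc, h01⟩ := exists_continuous_one_zero_of_isCompact
    ((CompactExhaustion.choice X).isCompact n) isClosed_empty (disjoint_empty _)
  exact ⟨⟨f, hc⟩, fun p hp => hf hp, fun p => (h01 p).1⟩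

variable (X) in
/-- Nonnegative functions with compact support, the `n`-th one being `1` on the `n`-th set of a
compact exhaustion of `X`. -/
def cutoff (n : ℕ) : C_c(X, ℝ) := (exists_cutoff X n).choose

theorem cutoff_eq_one {n : ℕ} {p : X} (hp : p ∈ CompactExhaustion.choice X n) :
    cutoff X n p = 1 :=
  (exists_cutoff X n).choose_spec.1 p hp

theorem cutoff_nonneg (n : ℕ) (p : X) : 0 ≤ cutoff X n p :=
  (exists_cutoff X n).choose_spec.2 p

/-- The product of a compactly supported function and a continuous function. -/
def mulContinuous (g : C_c(X, ℝ)) (q : C(X, ℝ)) : C_c(X, ℝ) :=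
  ⟨⟨fun p => g p * q p, by fun_prop⟩, g.hasCompactSupport.mul_right⟩

variable (X) in
/-- A countable family of test functions which determines the vague topology: the cutoff functions,
to control the mass on compact sets, and their products with a dense sequence in `C(X, ℝ)`. -/
def testFamily (k : Option ℕ × ℕ) : C_c(X, ℝ) :=
  match k.1 with
  | none => cutoff X k.2
  | some j => mulContinuous (cutoff X k.2) (TopologicalSpace.denseSeq C(X, ℝ) j)

theorem exists_testFamily_near (f : C_c(X, ℝ)) : ∃ n, ∀ ε > 0, ∃ k,
    ∀ p, |f p - testFamily X k p| ≤ ε * cutoff X n p := by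
  obtain ⟨n, hn⟩ := (CompactExhaustion.choice X).exists_superset_of_isCompact f.hasCompactSupport
  refine ⟨n, fun ε hε => ?_⟩
  obtain ⟨j, hj⟩ := exists_denseSeq_near (f : C(X, ℝ)) (cutoff X n).hasCompactSupport hε
  refine ⟨(some j, n), fun p => ?_⟩
  have hfp : f p = cutoff X n p * f p := by
    by_cases hp : p ∈ tsupport f
    · rw [cutoff_eq_one (hn hp), one_mul]
    · rw [image_eq_zero_of_notMem_tsupport hp, mul_zero]
  have hdiff : f p - testFamily X (some j, n) p =
      cutoff X n p * (f p - TopologicalSpace.denseSeq C(X, ℝ) j p) := by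
    rw [mul_sub, ← hfp]
    rfl
  rw [hdiff, abs_mul, abs_of_nonneg (cutoff_nonneg n p), mul_comm ε]
  by_cases hp : p ∈ tsupport (cutoff X n)
  · exact mul_le_mul_of_nonneg_left (hj p hp).le (cutoff_nonneg n p)
  · rw [image_eq_zero_of_notMem_tsupport hp, zero_mul, zero_mul]

variable [MeasurableSpace X]

/-- The finite measure obtained by multiplying `ν` with the density `cutoff X n`. -/
def cutoffMeasure (ν : Measure X) (n : ℕ) : Measure X :=
  ν.withDensity fun p => ENNReal.ofReal (cutoff X n p)

theorem cutoffMeasure_apply (ν : Measure X) {n : ℕ} {A : Set X} (hA : MeasurableSet A)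
    (hAn : A ⊆ CompactExhaustion.choice X n) : cutoffMeasure ν n A = ν A := by
  rw [cutoffMeasure, withDensity_apply _ hA, setLIntegral_congr_fun (g := fun _ => 1) hA
    fun p hp => by rw [cutoff_eq_one (hAn hp), ENNReal.ofReal_one], setLIntegral_one]

variable [BorelSpace X]

theorem induced_integral_eq_induced_integral_testFamily {β : Type*} (M : β → Measure X)
    [∀ b, IsFiniteMeasureOnCompacts (M b)] :
    TopologicalSpace.induced (fun b (f : C_c(X, ℝ)) => ∫ p, f p ∂M b) inferInstance =
      TopologicalSpace.induced (fun b k => ∫ p, testFamily X k p ∂M b) inferInstance := by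
  refine le_antisymm ?_ ?_
  · let T : TopologicalSpace β :=
      TopologicalSpace.induced (fun b (f : C_c(X, ℝ)) => ∫ p, f p ∂M b) inferInstance
    change T ≤ TopologicalSpace.induced _ _
    rw [← continuous_iff_le_induced]
    exact continuous_pi fun k => (continuous_apply (testFamily X k)).comp
      (continuous_induced_dom (f := fun b (f : C_c(X, ℝ)) => ∫ p, f p ∂M b))
  · let T : TopologicalSpace β :=
      TopologicalSpace.induced (fun b k => ∫ p, testFamily X k p ∂M b) inferInstance
    have hT (k) : Continuous[T, _] fun b => ∫ p, testFamily X k p ∂M b :=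
      (continuous_apply k).comp
        (continuous_induced_dom (f := fun b k => ∫ p, testFamily X k p ∂M b))
    change T ≤ TopologicalSpace.induced _ _
    rw [← continuous_iff_le_induced]
    refine continuous_pi fun f => ?_
    refine continuous_of_locally_uniform_approx_of_continuousAt fun b₀ u hu => ?_
    obtain ⟨ε, hε, hu⟩ := Metric.mem_uniformity_dist.1 hu
    obtain ⟨n, hn⟩ := exists_testFamily_near f
    set C : ℝ := ∫ p, cutoff X n p ∂M b₀ + 1
    have hC : 0 < C := add_pos_of_nonneg_of_pos (integral_nonneg (cutoff_nonneg n)) one_pos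
    obtain ⟨k, hk⟩ := hn (ε / (2 * C)) (by positivity)
    exact ⟨{b | ∫ p, cutoff X n p ∂M b < C},
      (isOpen_lt (hT (none, n)) continuous_const).mem_nhds (lt_add_one (∫ p, cutoff X n p ∂M b₀)),
      fun b => ∫ p, testFamily X k p ∂M b, (hT k).continuousAt,
      fun b hb => hu (abs_integral_sub_integral_lt (M b) hε hC hk hb)⟩

instance (ν : Measure X) [IsFiniteMeasureOnCompacts ν] (n : ℕ) :
    IsFiniteMeasure (cutoffMeasure ν n) :=
  isFiniteMeasure_withDensity ((cutoff X n).continuous.integrable_of_hasCompactSupport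
    (cutoff X n).hasCompactSupport).lintegral_lt_top.ne

theorem lintegral_cutoffMeasure (ν : Measure X) [IsFiniteMeasureOnCompacts ν] (n : ℕ)
    (q : C(X, NNReal)) : ∫⁻ p, q p ∂cutoffMeasure ν n =
      ENNReal.ofReal (∫ p, mulContinuous (cutoff X n) ⟨fun p => (q p : ℝ), by fun_prop⟩ p ∂ν) := by
  rw [cutoffMeasure, lintegral_withDensity_eq_lintegral_mul _ (by fun_prop) (by fun_prop),
    ofReal_integral_eq_lintegral_ofReal
      ((map_continuous _).integrable_of_hasCompactSupport
        (CompactlySupportedContinuousMap.hasCompactSupport _))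
      (ae_of_all _ fun p => mul_nonneg (cutoff_nonneg n p) (q p).2)]
  refine lintegral_congr fun p => ?_
  change _ = ENNReal.ofReal (cutoff X n p * q p)
  rw [ENNReal.ofReal_mul (cutoff_nonneg n p), ENNReal.ofReal_coe_nnreal]
  rfl

variable {β : Type*} [MeasurableSpace β] {M : β → Measure X}

theorem measurable_cutoffMeasure [∀ b, IsFiniteMeasureOnCompacts (M b)]
    (hM : ∀ f : C_c(X, ℝ), Measurable fun b => ∫ p, f p ∂M b) (n : ℕ) :
    Measurable fun b => cutoffMeasure (M b) n := by
  have hclosed (F : Set X) (hF : IsClosed F) : Measurable fun b => cutoffMeasure (M b) n F := by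
    refine measurable_of_tendsto_metrizable (fun k => ?_) (tendsto_pi_nhds.2 fun b =>
      HasOuterApproxClosed.tendsto_lintegral_apprSeq hF (cutoffMeasure (M b) n))
    have hint := fun b => lintegral_cutoffMeasure (M b) n (hF.apprSeq k)
    simp only [ContinuousMap.coe_coe] at hint
    simp only [hint]
    exact (hM _).ennreal_ofReal
  exact Measurable.measure_of_isPiSystem
    ((BorelSpace.measurable_eq (α := X)).trans borel_eq_generateFrom_isClosed)
    isPiSystem_isClosed hclosed (hclosed univ isClosed_univ)

theorem measurable_of_measurable_integral [∀ b, IsFiniteMeasureOnCompacts (M b)]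
    (hM : ∀ f : C_c(X, ℝ), Measurable fun b => ∫ p, f p ∂M b) : Measurable M := by
  refine Measure.measurable_of_measurable_coe _ fun A hA => ?_
  set K := CompactExhaustion.choice X
  have hmeas (n : ℕ) : MeasurableSet (A ∩ K n) := hA.inter (K.isCompact n).measurableSet
  have hmono : Monotone fun n => A ∩ K n := fun a b hab =>
    inter_subset_inter_right _ (K.subset hab)
  have hsup (b : β) : M b A = ⨆ n, cutoffMeasure (M b) n (A ∩ K n) := by
    simp_rw [cutoffMeasure_apply (M b) (hmeas _) inter_subset_right]
    rw [← hmono.measure_iUnion, ← inter_iUnion, K.iUnion_eq, inter_univ]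
  simp_rw [hsup]
  exact Measurable.iSup fun n =>
    (Measure.measurable_coe (hmeas n)).comp (measurable_cutoffMeasure hM n)

end Vague

/-! ### Measurability of coloured parts and translations -/

section PointMeasure

variable {d m : ℕ}

instance (lam : PointMeasure d m) : IsFiniteMeasureOnCompacts lam.toMeasure where
  lt_top_of_isCompact K hK := by
    obtain ⟨n, hn⟩ := lam.exists_nat K hK.measurableSet (by rwa [hK.isClosed.closure_eq])
    rw [hn]
    exact ENNReal.natCast_lt_top n

/-- The integrals of a point measure against the countably many functions `testFamily`; they embed
the space of point measures into a second countable space. -/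
def testIntegrals (lam : PointMeasure d m) (k : Option ℕ × ℕ) : ℝ :=
  ∫ p, testFamily (ColSpace d m) k p ∂lam.toMeasure

theorem isInducing_testIntegrals : IsInducing (testIntegrals : PointMeasure d m → _) :=
  ⟨induced_integral_eq_induced_integral_testFamily PointMeasure.toMeasure⟩

instance : SecondCountableTopology (PointMeasure d m) :=
  isInducing_testIntegrals.secondCountableTopology

theorem measurable_of_measurable_toMeasure {α : Type*} [MeasurableSpace α]
    {g : α → PointMeasure d m} (hg : Measurable fun a => (g a).toMeasure) : Measurable g := by
  have hborel : borel (PointMeasure d m) =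
      MeasurableSpace.comap testIntegrals MeasurableSpace.pi := by
    rw [isInducing_testIntegrals.eq_induced, borel_comap,
      BorelSpace.measurable_eq (α := (Option ℕ × ℕ → ℝ))]
  suffices @Measurable _ _ _ (MeasurableSpace.comap testIntegrals MeasurableSpace.pi) g by
    rwa [← hborel] at this
  refine measurable_comap_iff.2 (measurable_pi_iff.2 fun k => ?_)
  change Measurable fun a => ∫ p, testFamily (ColSpace d m) k p ∂(g a).toMeasure
  have hint (a : α) : Integrable (testFamily (ColSpace d m) k) (g a).toMeasure :=
    (testFamily (ColSpace d m) k).continuous.integrable_of_hasCompactSupport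
      (testFamily (ColSpace d m) k).hasCompactSupport
  simp_rw [fun a => integral_eq_lintegral_pos_part_sub_lintegral_neg_part (hint a)]
  exact ((Measure.measurable_lintegral (by fun_prop)).comp hg).ennreal_toReal.sub
    ((Measure.measurable_lintegral (by fun_prop)).comp hg).ennreal_toReal

theorem PointMeasure.measurable_toMeasure :
    Measurable (PointMeasure.toMeasure : PointMeasure d m → _) :=
  measurable_of_measurable_integral fun f => ((continuous_apply f).comp (continuous_induced_dom
    (f := fun (lam : PointMeasure d m) (f : C_c(ColSpace d m, ℝ)) =>
      ∫ p, f p ∂lam.toMeasure))).measurable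

theorem PointMeasure.colour_apply (lam : PointMeasure d m) (i : Fin m) (A : Set (Space d)) :
    lam.colour i A = lam.toMeasure (A ×ˢ {i}) := by
  rw [PointMeasure.colour, (measurableEmbedding_prod_mk_right i).comap_apply, prod_singleton]

theorem PointMeasure.measurable_colour (i : Fin m) :
    Measurable fun lam : PointMeasure d m => lam.colour i := by
  refine Measure.measurable_of_measurable_coe _ fun A hA => ?_
  simp_rw [PointMeasure.colour_apply]
  exact (Measure.measurable_coe (hA.prod (measurableSet_singleton i))).comp
    PointMeasure.measurable_toMeasure

theorem PointMeasure.toMeasure_apply_eq_sum (lam : PointMeasure d m) {A : Set (ColSpace d m)}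
    (hA : MeasurableSet A) :
    lam.toMeasure A = ∑ i, lam.colour i ((fun x => (x, i)) ⁻¹' A) := by
  have hunion : A = ⋃ i : Fin m, ((fun x => (x, i)) ⁻¹' A) ×ˢ {i} := by
    ext ⟨x, j⟩
    simp
  conv_lhs => rw [hunion]
  rw [measure_iUnion, tsum_fintype]
  · simp_rw [PointMeasure.colour_apply]
  · exact fun i j hij => Set.Disjoint.set_prod_right (disjoint_singleton.2 hij) _ _
  · exact fun i => (measurable_prodMk_right hA).prod (measurableSet_singleton i)

instance (lam : PointMeasure d m) (i : Fin m) : IsFiniteMeasureOnCompacts (lam.colour i) where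
  lt_top_of_isCompact K hK := by
    rw [PointMeasure.colour_apply]
    exact (hK.prod isCompact_singleton).measure_lt_top

instance (lam : PointMeasure d m) (i : Fin m) : IsLocallyFiniteMeasure (lam.colour i) :=
  isLocallyFiniteMeasure_of_isFiniteMeasureOnCompacts

theorem measurable_of_measurable_colour {α : Type*} [MeasurableSpace α] {g : α → PointMeasure d m}
    (h : ∀ i, Measurable fun a => (g a).colour i) : Measurable g := by
  refine measurable_of_measurable_toMeasure (Measure.measurable_of_measurable_coe _ fun A hA => ?_)
  simp_rw [PointMeasure.toMeasure_apply_eq_sum _ hA]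
  exact Finset.measurable_sum _ fun i _ =>
    (Measure.measurable_coe (measurable_prodMk_right hA)).comp (h i)

theorem PointMeasure.colour_vadd (t : Space d) (lam : PointMeasure d m) (i : Fin m) :
    (t +ᵥ lam).colour i = (lam.colour i).map (t + ·) := by
  ext A hA
  rw [Measure.map_apply (by fun_prop) hA, PointMeasure.colour_apply, PointMeasure.colour_apply]
  exact Measure.map_apply (measurable_colTranslate t) (hA.prod (measurableSet_singleton i))

/-- The part of colour `i` of a point measure as a kernel. -/
def colourKernel (d m : ℕ) (i : Fin m) : Kernel (PointMeasure d m) (Space d) :=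
  ⟨fun lam => lam.colour i, PointMeasure.measurable_colour i⟩

end PointMeasure

/-! ### Palm measures and Campbell's formula -/

section Kernels

variable {α β : Type*} [MeasurableSpace α] [MeasurableSpace β]

theorem isSFiniteKernel_of_apply_univ_ne_top (κ : Kernel α β) (h : ∀ a, κ a univ ≠ ∞) :
    IsSFiniteKernel κ := by
  have hmeas := κ.measurable_coe MeasurableSet.univ
  let η : Kernel α β := ⟨fun a => (κ a univ)⁻¹ • κ a,
    Measure.measurable_of_measurable_coe _ fun s hs => hmeas.inv.mul (κ.measurable_coe hs)⟩
  have hη : IsFiniteKernel η := ⟨1, ENNReal.one_lt_top, fun a => ENNReal.inv_mul_le_one _⟩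
  have hκ : κ = η.withDensity fun a _ => κ a univ := by
    ext a s
    rw [Kernel.withDensity_apply η (f := fun a _ => κ a univ) (hmeas.comp measurable_fst),
      withDensity_const]
    change κ a s = κ a univ * ((κ a univ)⁻¹ * κ a s)
    by_cases h0 : κ a univ = 0
    · rw [h0, zero_mul, Measure.measure_univ_eq_zero.1 h0, Measure.coe_zero, Pi.zero_apply]
    · rw [← mul_assoc, ENNReal.mul_inv_cancel h0 (h a), one_mul]
  rw [hκ]
  exact Kernel.IsSFiniteKernel.withDensity _ fun a _ => h a

theorem isSFiniteKernel_of_cover (κ : Kernel α β) (A : ℕ → Set β) (hA : ∀ n, MeasurableSet (A n))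
    (hU : ⋃ n, A n = univ) (hfin : ∀ a n, κ a (A n) ≠ ∞) : IsSFiniteKernel κ := by
  have hD (n) : MeasurableSet (disjointed A n) := MeasurableSet.disjointed hA n
  have hsum : κ = Kernel.sum fun n => κ.restrict (hD n) := by
    ext a : 1
    simp_rw [Kernel.sum_apply, Kernel.restrict_apply]
    rw [← Measure.restrict_iUnion (disjoint_disjointed A) hD, iUnion_disjointed, hU,
      Measure.restrict_univ]
  have hrestrict (n) : IsSFiniteKernel (κ.restrict (hD n)) :=
    isSFiniteKernel_of_apply_univ_ne_top _ fun a => by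
      rw [Kernel.restrict_apply, Measure.restrict_apply_univ]
      exact measure_ne_top_of_subset (disjointed_subset A n) (hfin a n)
  rw [hsum]
  infer_instance

end Kernels

section Palm

variable {d m : ℕ}

instance (i : Fin m) : IsSFiniteKernel (colourKernel d m i) :=
  isSFiniteKernel_of_cover _ (fun n => CompactExhaustion.choice (Space d) n)
    (fun n => ((CompactExhaustion.choice (Space d)).isCompact n).measurableSet)
    (CompactExhaustion.choice (Space d)).iUnion_eq
    fun lam n => ((CompactExhaustion.choice (Space d)).isCompact n).measure_ne_top
      (μ := lam.colour i)

theorem measurable_lintegral_colour {α : Type*} [MeasurableSpace α] (i : Fin m)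
    {g : α → PointMeasure d m} (hg : Measurable g) {F : α → Space d → ℝ≥0∞}
    (hF : Measurable (Function.uncurry F)) :
    Measurable fun a => ∫⁻ x, F a x ∂((g a).colour i) :=
  Measurable.lintegral_kernel_prod_right (κ := (colourKernel d m i).comap g hg) hF

theorem measurable_vadd_pointMeasure :
    Measurable fun p : Space d × PointMeasure d m => p.1 +ᵥ p.2 := by
  refine measurable_of_measurable_colour fun i =>
    Measure.measurable_of_measurable_coe _ fun A hA => ?_
  have hcolour (p : Space d × PointMeasure d m) :
      (p.1 +ᵥ p.2).colour i A = ∫⁻ x, A.indicator 1 (p.1 + x) ∂(p.2.colour i) := by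
    rw [PointMeasure.colour_vadd, ← lintegral_indicator_one hA,
      lintegral_map (measurable_one.indicator hA) (by fun_prop)]
  simp_rw [hcolour]
  exact measurable_lintegral_colour i measurable_snd
    ((measurable_one.indicator hA).comp (by fun_prop))

theorem measurable_neg_vadd (lam : PointMeasure d m) : Measurable fun x : Space d => -x +ᵥ lam :=
  measurable_vadd_pointMeasure.comp (measurable_id.neg.prodMk measurable_const)

instance : MeasurableConstVAdd (Space d) (PointMeasure d m) :=
  ⟨fun _ => measurable_vadd_pointMeasure.comp measurable_prodMk_left⟩

theorem measurableSet_cube (d : ℕ) (R : ℝ) : MeasurableSet (cube d R) := by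
  simp only [cube, ofPred_forall]
  exact MeasurableSet.iInter fun j => measurableSet_lt (by fun_prop) measurable_const

theorem volume_cube_one (d : ℕ) : volume (cube d 1) = 1 := by
  have hcube : cube d 1 = (WithLp.ofLp : Space d → (Fin d → ℝ)) ⁻¹'
      (Set.pi univ fun _ => Ioo (-(1 / 2)) (1 / 2)) := by
    ext x
    simp [cube, abs_lt]
  rw [hcube, (PiLp.volume_preserving_ofLp (Fin d)).measure_preimage
    (MeasurableSet.univ_pi fun _ => measurableSet_Ioo).nullMeasurableSet, Real.volume_pi_Ioo]
  norm_num

/-- The kernel which gives the Palm measure with respect to the points of colour `i`. -/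
def palmKernel (d m : ℕ) (i : Fin m) : Kernel (PointMeasure d m) (PointMeasure d m) where
  toFun lam := ((lam.colour i).restrict (cube d 1)).map fun x : Space d => -x +ᵥ lam
  measurable' := by
    refine Measure.measurable_of_measurable_coe _ fun s hs => ?_
    have hmem : MeasurableSet {q : PointMeasure d m × Space d | -q.2 +ᵥ q.1 ∈ s ∧ q.2 ∈ cube d 1} :=
      ((measurable_vadd_pointMeasure.comp (measurable_snd.neg.prodMk measurable_fst)) hs).inter
        (measurable_snd (measurableSet_cube d 1))
    convert Kernel.measurable_kernel_prodMk_left (κ := colourKernel d m i) hmem using 2 with lam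
    rw [Measure.map_apply (measurable_neg_vadd lam) hs,
      Measure.restrict_apply (measurable_neg_vadd lam hs)]
    rfl

theorem palm_eq_bind (μ : Measure (PointMeasure d m)) (i : Fin m) :
    palm μ i = μ.bind (palmKernel d m i) := rfl

theorem lintegral_palm (μ : Measure (PointMeasure d m)) (i : Fin m)
    {F : PointMeasure d m → ℝ≥0∞} (hF : Measurable F) :
    ∫⁻ lam, F lam ∂(palm μ i) =
      ∫⁻ lam, ∫⁻ x in cube d 1, F (-x +ᵥ lam) ∂(lam.colour i) ∂μ := by
  rw [palm_eq_bind, Measure.lintegral_bind (palmKernel d m i).aemeasurable hF.aemeasurable]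
  exact lintegral_congr fun lam => lintegral_map hF (measurable_neg_vadd lam)

theorem lintegral_lintegral_cube_indicator_mul (ν : Measure (Space d)) [SFinite ν]
    {g : Space d → ℝ≥0∞} (hg : Measurable g) :
    ∫⁻ a, ∫⁻ x, (cube d 1).indicator 1 (x - a) * g x ∂ν = ∫⁻ x, g x ∂ν := by
  have hcube : Measurable ((cube d 1).indicator (1 : Space d → ℝ≥0∞)) :=
    measurable_one.indicator (measurableSet_cube d 1)
  rw [lintegral_lintegral_swap (by fun_prop)]
  refine lintegral_congr fun x => ?_
  rw [lintegral_mul_const _ (by fun_prop),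
    lintegral_sub_left_eq_self ((cube d 1).indicator 1) x,
    lintegral_indicator_one (measurableSet_cube d 1), volume_cube_one, one_mul]

theorem lintegral_lintegral_cube_indicator_mul_add (ν : Measure (Space d)) [SFinite ν]
    {Ψ : Space d → Space d → ℝ≥0∞} (hΨ : Measurable (Function.uncurry Ψ)) :
    ∫⁻ a, ∫⁻ x, (cube d 1).indicator 1 x * Ψ (a + x) x ∂ν =
      ∫⁻ x in cube d 1, (∫⁻ a, Ψ a x) ∂ν := by
  have hcube : Measurable ((cube d 1).indicator (1 : Space d → ℝ≥0∞)) :=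
    measurable_one.indicator (measurableSet_cube d 1)
  have hΨadd : Measurable fun p : Space d × Space d => Ψ (p.1 + p.2) p.2 :=
    hΨ.comp (by fun_prop : Measurable fun p : Space d × Space d => (p.1 + p.2, p.2))
  rw [lintegral_lintegral_swap ((hcube.comp measurable_snd).mul hΨadd).aemeasurable,
    ← lintegral_indicator (measurableSet_cube d 1)]
  refine lintegral_congr fun x => ?_
  have hΨx : Measurable fun a => Ψ (a + x) x := hΨadd.comp measurable_prodMk_right
  rw [lintegral_const_mul _ hΨx,
    lintegral_add_right_eq_self (fun a => Ψ a x) x]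
  by_cases hx : x ∈ cube d 1
  · rw [indicator_of_mem hx, indicator_of_mem hx, Pi.one_apply, one_mul]
  · rw [indicator_of_notMem hx, indicator_of_notMem hx, zero_mul]

section Campbell

variable (μ : Measure (PointMeasure d m)) [VAddInvariantMeasure (Space d) (PointMeasure d m) μ]
  [SFinite μ]

theorem lintegral_lintegral_colour_eq_palm (i : Fin m) {Φ : Space d → PointMeasure d m → ℝ≥0∞}
    (hΦ : Measurable (Function.uncurry Φ)) :
    ∫⁻ lam, ∫⁻ x, Φ x (-x +ᵥ lam) ∂(lam.colour i) ∂μ =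
      ∫⁻ lam, (∫⁻ a, Φ a lam) ∂(palm μ i) := by
  have hcube : Measurable ((cube d 1).indicator (1 : Space d → ℝ≥0∞)) :=
    measurable_one.indicator (measurableSet_cube d 1)
  let G (a : Space d) (lam : PointMeasure d m) : ℝ≥0∞ :=
    ∫⁻ x, (cube d 1).indicator 1 (x - a) * Φ x (-x +ᵥ lam) ∂(lam.colour i)
  have hG : Measurable (Function.uncurry G) := measurable_lintegral_colour i measurable_snd
    ((hcube.comp (by fun_prop)).mul (hΦ.comp (measurable_snd.prodMk
      (measurable_vadd_pointMeasure.comp (measurable_snd.neg.prodMk (by fun_prop))))))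
  have hslice (lam : PointMeasure d m) : Measurable fun x => Φ x (-x +ᵥ lam) :=
    hΦ.comp (measurable_id.prodMk (measurable_neg_vadd lam))
  have hGvadd (a : Space d) (lam : PointMeasure d m) : G a (a +ᵥ lam) =
      ∫⁻ x, (cube d 1).indicator 1 x * Φ (a + x) (-x +ᵥ lam) ∂(lam.colour i) := by
    simp only [G]
    have hmeas : Measurable fun x => (cube d 1).indicator 1 (x - a) * Φ x (-x +ᵥ a +ᵥ lam) :=
      (hcube.comp (by fun_prop)).mul (hslice (a +ᵥ lam))
    rw [PointMeasure.colour_vadd, lintegral_map hmeas (by fun_prop)]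
    simp only [add_sub_cancel_left, vadd_vadd, neg_add_rev, neg_add_cancel_right]
  calc ∫⁻ lam, ∫⁻ x, Φ x (-x +ᵥ lam) ∂(lam.colour i) ∂μ
      = ∫⁻ lam, (∫⁻ a, G a lam) ∂μ := lintegral_congr fun lam =>
        (lintegral_lintegral_cube_indicator_mul (lam.colour i) (hslice lam)).symm
    _ = ∫⁻ a, (∫⁻ lam, G a lam ∂μ) :=
        lintegral_lintegral_swap (hG.comp measurable_swap).aemeasurable
    _ = ∫⁻ a, (∫⁻ lam, G a (a +ᵥ lam) ∂μ) := lintegral_congr fun a =>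
        ((measurePreserving_vadd a μ).lintegral_comp (hG.comp measurable_prodMk_left)).symm
    _ = ∫⁻ lam, (∫⁻ a, G a (a +ᵥ lam)) ∂μ := lintegral_lintegral_swap
        (hG.comp (measurable_fst.prodMk measurable_vadd_pointMeasure)).aemeasurable
    _ = ∫⁻ lam, ∫⁻ x in cube d 1, (∫⁻ a, Φ a (-x +ᵥ lam)) ∂(lam.colour i) ∂μ := by
        simp_rw [hGvadd]
        exact lintegral_congr fun lam => lintegral_lintegral_cube_indicator_mul_add _
          (Ψ := fun a x => Φ a (-x +ᵥ lam))
          (hΦ.comp (measurable_fst.prodMk ((measurable_neg_vadd lam).comp measurable_snd)))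
    _ = ∫⁻ lam, (∫⁻ a, Φ a lam) ∂(palm μ i) :=
        (lintegral_palm μ i (Measurable.lintegral_prod_left hΦ)).symm

end Campbell

/-- The first moment of colour `j` of the Palm measure with respect to colour `i`. -/
def pairMoment (μ : Measure (PointMeasure d m)) (i j : Fin m) : Measure (Space d) :=
  (palm μ i).bind (colourKernel d m j)

theorem lintegral_pairMoment (μ : Measure (PointMeasure d m)) (i j : Fin m)
    {h : Space d → ℝ≥0∞} (hh : Measurable h) :
    ∫⁻ z, h z ∂(pairMoment μ i j) = ∫⁻ lam, ∫⁻ z, h z ∂(lam.colour j) ∂(palm μ i) :=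
  Measure.lintegral_bind (colourKernel d m j).aemeasurable hh.aemeasurable

theorem lintegral_colour_neg_vadd (lam : PointMeasure d m) (j : Fin m) (x : Space d)
    {h : Space d → ℝ≥0∞} (hh : Measurable h) :
    ∫⁻ z, h z ∂((-x +ᵥ lam).colour j) = ∫⁻ y, h (y - x) ∂(lam.colour j) := by
  rw [PointMeasure.colour_vadd, lintegral_map hh (by fun_prop)]
  simp_rw [neg_add_eq_sub]

theorem lintegral_lintegral_lintegral_colour (μ : Measure (PointMeasure d m))
    [VAddInvariantMeasure (Space d) (PointMeasure d m) μ] [SFinite μ] (i j : Fin m)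
    {F : Space d → Space d → ℝ≥0∞} (hF : Measurable (Function.uncurry F)) :
    ∫⁻ lam, ∫⁻ x, ∫⁻ y, F x (y - x) ∂(lam.colour j) ∂(lam.colour i) ∂μ =
      ∫⁻ z, (∫⁻ a, F a z) ∂(pairMoment μ i j) := by
  have hΦ : Measurable (Function.uncurry fun (a : Space d) (lam : PointMeasure d m) =>
      ∫⁻ z, F a z ∂(lam.colour j)) :=
    measurable_lintegral_colour j measurable_snd (F := fun q z => F q.1 z)
      (hF.comp (by fun_prop : Measurable fun q : (Space d × PointMeasure d m) × Space d =>
        (q.1.1, q.2)))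
  calc ∫⁻ lam, ∫⁻ x, ∫⁻ y, F x (y - x) ∂(lam.colour j) ∂(lam.colour i) ∂μ
      = ∫⁻ lam, ∫⁻ x, ∫⁻ z, F x z ∂((-x +ᵥ lam).colour j) ∂(lam.colour i) ∂μ :=
        lintegral_congr fun lam => lintegral_congr fun x =>
          (lintegral_colour_neg_vadd lam j x (hF.comp measurable_prodMk_left)).symm
    _ = ∫⁻ lam, (∫⁻ a, ∫⁻ z, F a z ∂(lam.colour j)) ∂(palm μ i) :=
        lintegral_lintegral_colour_eq_palm μ i hΦ
    _ = ∫⁻ lam, ∫⁻ z, (∫⁻ a, F a z) ∂(lam.colour j) ∂(palm μ i) :=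
        lintegral_congr fun lam => lintegral_lintegral_swap hF.aemeasurable
    _ = ∫⁻ z, (∫⁻ a, F a z) ∂(pairMoment μ i j) :=
        (lintegral_pairMoment μ i j (Measurable.lintegral_prod_left hF)).symm

end Palm

/-! ### Uniformly discrete point measures -/

section Bounds

variable {d m : ℕ} {r : ℝ}

theorem measure_ball_le_mul_lintegral_decayWeight {E : Type*} [NormedAddCommGroup E]
    [NormedSpace ℝ E] [MeasurableSpace E] [OpensMeasurableSpace E] (ρ : Measure E) {R : ℝ}
    (hR : 0 < R) : ρ (Metric.ball 0 R) ≤ ENNReal.ofReal ((1 + R) ^ (Module.finrank ℝ E + 1)) *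
      ∫⁻ x, ENNReal.ofReal (decayWeight x) ∂ρ := by
  rw [← lintegral_const_mul' _ _ ENNReal.ofReal_ne_top]
  calc ρ (Metric.ball 0 R) = ∫⁻ _ in Metric.ball 0 R, 1 ∂ρ := (setLIntegral_one _).symm
    _ ≤ ∫⁻ x in Metric.ball 0 R, ENNReal.ofReal ((1 + R) ^ (Module.finrank ℝ E + 1)) *
          ENNReal.ofReal (decayWeight x) ∂ρ := by
        refine setLIntegral_mono' measurableSet_ball fun x hx => ?_
        rw [← ENNReal.ofReal_mul (by positivity), ENNReal.one_le_ofReal]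
        simpa [decayWeight] using decayWeight_le_mul_decayWeight hR (x := 0) (y := x) hx
    _ ≤ _ := setLIntegral_le_lintegral _ _

theorem isBounded_cube (d : ℕ) (R : ℝ) : Bornology.IsBounded (cube d R) := by
  refine ((PiLp.antilipschitzWith_ofLp 2 _).isBounded_preimage
    (Metric.isBounded_closedBall (x := (0 : Fin d → ℝ)) (r := |R / 2|))).subset fun x hx => ?_
  rw [mem_preimage, mem_closedBall_zero_iff, pi_norm_le_iff_of_nonneg (abs_nonneg _)]
  exact fun j => (hx j).le.trans (le_abs_self _)

theorem sum_colour_ball_le {lam : PointMeasure d m} (h : lam ∈ uniformlyDiscrete d m r)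
    (a : Space d) : ∑ i, lam.colour i (Metric.ball a (r / 2)) ≤ 1 := by
  calc ∑ i, lam.colour i (Metric.ball a (r / 2))
      = lam.toMeasure (Metric.ball a (r / 2) ×ˢ univ) := by
        rw [PointMeasure.toMeasure_apply_eq_sum _ (measurableSet_ball.prod MeasurableSet.univ)]
        simp
    _ ≤ lam.toMeasure (((fun x => a + x) '' cube d r) ×ˢ univ) :=
        measure_mono (Set.prod_mono (fun y hy => ⟨y - a, fun j =>
          (PiLp.norm_apply_le (y - a) j).trans_lt (by simpa [dist_eq_norm] using hy),
          add_sub_cancel a y⟩) subset_rfl)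
    _ ≤ 1 := h a

theorem colour_ball_le {lam : PointMeasure d m} (h : lam ∈ uniformlyDiscrete d m r) (i : Fin m)
    (a : Space d) : lam.colour i (Metric.ball a (r / 2)) ≤ 1 :=
  (Finset.single_le_sum (f := fun i => lam.colour i _) (fun _ _ => zero_le)
    (Finset.mem_univ i)).trans (sum_colour_ball_le h a)

theorem exists_lintegral_colour_decayWeight_le (d m : ℕ) (hr : 0 < r) :
    ∃ C : ℝ≥0∞, C ≠ ∞ ∧ ∀ lam ∈ uniformlyDiscrete d m r, ∀ i,
      ∫⁻ x, ENNReal.ofReal (decayWeight x) ∂(lam.colour i) ≤ C := by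
  obtain ⟨C, hC, h⟩ := exists_lintegral_decayWeight_le (Space d) (half_pos hr)
  exact ⟨C, hC, fun lam hlam i => by simpa using h (lam.colour i) 1 (colour_ball_le hlam i)⟩

theorem exists_colour_le_of_isBounded (m : ℕ) (hr : 0 < r) {s : Set (Space d)}
    (hs : Bornology.IsBounded s) :
    ∃ K : ℝ≥0∞, K ≠ ∞ ∧ ∀ lam ∈ uniformlyDiscrete d m r, ∀ i, lam.colour i s ≤ K := by
  obtain ⟨C, hC, h⟩ := exists_lintegral_colour_decayWeight_le (r := r) d m hr
  obtain ⟨R, hR, hsR⟩ := hs.subset_ball_lt 0 0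
  refine ⟨ENNReal.ofReal ((1 + R) ^ (Module.finrank ℝ (Space d) + 1)) * C,
    ENNReal.mul_ne_top ENNReal.ofReal_ne_top hC, fun lam hlam i => (measure_mono hsR).trans <|
      (measure_ball_le_mul_lintegral_decayWeight _ hR).trans ?_⟩
  gcongr
  exact h lam hlam i

theorem exists_lintegral_colour_enorm_le (d m : ℕ) (hr : 0 < r) :
    ∃ C : ℝ≥0∞, C ≠ ∞ ∧ ∀ lam ∈ uniformlyDiscrete d m r, ∀ i, ∀ (f : Space d → ℂ) (B : ℝ),
      0 ≤ B → (∀ x, ‖f x‖ ≤ B * decayWeight x) →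
        ∫⁻ x, ‖f x‖ₑ ∂(lam.colour i) ≤ ENNReal.ofReal B * C := by
  obtain ⟨C, hC, h⟩ := exists_lintegral_colour_decayWeight_le (r := r) d m hr
  refine ⟨C, hC, fun lam hlam i f B hB hf =>
    (lintegral_enorm_le_of_norm_le_mul_decayWeight hB hf).trans ?_⟩
  gcongr
  exact h lam hlam i

theorem exists_lintegral_colour_schwartz_le (m : ℕ) (hr : 0 < r) (f : 𝓢(Space d, ℂ)) :
    ∃ C : ℝ≥0∞, C ≠ ∞ ∧ ∀ lam ∈ uniformlyDiscrete d m r, ∀ i,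
      ∫⁻ x, ‖f x‖ₑ ∂(lam.colour i) ≤ C := by
  obtain ⟨C, hC, h⟩ := exists_lintegral_colour_enorm_le (r := r) d m hr
  obtain ⟨B, hB, hf⟩ := exists_norm_le_mul_decayWeight f
  exact ⟨_, ENNReal.mul_ne_top ENNReal.ofReal_ne_top hC, fun lam hlam i => h lam hlam i f B hB hf⟩

theorem integrable_colour (hr : 0 < r) {lam : PointMeasure d m}
    (hlam : lam ∈ uniformlyDiscrete d m r) (i : Fin m) (f : 𝓢(Space d, ℂ)) :
    Integrable f (lam.colour i) := by
  obtain ⟨C, hC, h⟩ := exists_lintegral_colour_schwartz_le m hr f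
  exact ⟨f.continuous.aestronglyMeasurable, (h lam hlam i).trans_lt hC.lt_top⟩

theorem exists_norm_weightedCount_le (d : ℕ) (hr : 0 < r) (w : Fin m → ℝ) :
    ∃ C : ℝ, 0 ≤ C ∧ ∀ lam ∈ uniformlyDiscrete d m r, ∀ (f : Space d → ℂ) (B : ℝ),
      0 ≤ B → (∀ x, ‖f x‖ ≤ B * decayWeight x) → ‖weightedCount w f lam‖ ≤ B * C := by
  obtain ⟨C, hC, h⟩ := exists_lintegral_colour_enorm_le (r := r) d m hr
  refine ⟨∑ j, |w j| * C.toReal, by positivity, fun lam hlam f B hB hf => ?_⟩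
  have hcolour (j : Fin m) : ‖∫ x, f x ∂(lam.colour j)‖ ≤ B * C.toReal := by
    have hle := (enorm_integral_le_lintegral_enorm f).trans (h lam hlam j f B hB hf)
    simpa [ENNReal.toReal_mul, hB] using
      ENNReal.toReal_mono (ENNReal.mul_ne_top ENNReal.ofReal_ne_top hC) hle
  rw [weightedCount, Finset.mul_sum]
  refine norm_sum_le_of_le _ fun j _ => ?_
  rw [norm_mul, Complex.norm_real, Real.norm_eq_abs, mul_left_comm]
  exact mul_le_mul_of_nonneg_left (hcolour j) (abs_nonneg (w j))

theorem ae_mem_uniformlyDiscrete {μ : Measure (PointMeasure d m)}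
    (hX : μ.support ⊆ uniformlyDiscrete d m r) : ∀ᵐ lam ∂μ, lam ∈ uniformlyDiscrete d m r :=
  Filter.mem_of_superset Measure.support_mem_ae hX

variable {μ : Measure (PointMeasure d m)} [IsFiniteMeasure μ]

theorem exists_pairMoment_ball_le (hr : 0 < r) (hX : ∀ᵐ lam ∂μ, lam ∈ uniformlyDiscrete d m r)
    (i j : Fin m) :
    ∃ K : ℝ≥0∞, K ≠ ∞ ∧ ∀ a, pairMoment μ i j (Metric.ball a (r / 2)) ≤ K := by
  obtain ⟨K, hK, h⟩ := exists_colour_le_of_isBounded m hr (isBounded_cube d 1)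
  refine ⟨K * μ univ, ENNReal.mul_ne_top hK (measure_ne_top μ _), fun a => ?_⟩
  have hball : Measurable ((Metric.ball a (r / 2)).indicator (1 : Space d → ℝ≥0∞)) :=
    measurable_one.indicator measurableSet_ball
  rw [← lintegral_indicator_one measurableSet_ball, lintegral_pairMoment μ i j hball,
    lintegral_palm μ i (F := fun lam => ∫⁻ z, (Metric.ball a (r / 2)).indicator 1 z ∂(lam.colour j))
      (hball.lintegral_kernel (κ := colourKernel d m j)),
    ← lintegral_const]
  refine lintegral_mono_ae ?_
  filter_upwards [hX] with lam hlam
  calc ∫⁻ x in cube d 1, ∫⁻ y, (Metric.ball a (r / 2)).indicator 1 y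
        ∂((-x +ᵥ lam).colour j) ∂(lam.colour i)
      ≤ ∫⁻ _ in cube d 1, 1 ∂(lam.colour i) := lintegral_mono fun _ => by
        rw [lintegral_indicator_one measurableSet_ball, PointMeasure.colour_vadd,
          Measure.map_apply (by fun_prop) measurableSet_ball, preimage_add_ball]
        exact colour_ball_le hlam j _
    _ = lam.colour i (cube d 1) := setLIntegral_one _
    _ ≤ K := h lam hlam i

theorem isLocallyFiniteMeasure_pairMoment (hr : 0 < r)
    (hX : ∀ᵐ lam ∂μ, lam ∈ uniformlyDiscrete d m r) (i j : Fin m) :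
    IsLocallyFiniteMeasure (pairMoment μ i j) := by
  obtain ⟨K, hK, h⟩ := exists_pairMoment_ball_le hr hX i j
  exact isLocallyFiniteMeasure_of_ball_le (half_pos hr) hK h

theorem hasTemperateGrowth_pairMoment (hr : 0 < r)
    (hX : ∀ᵐ lam ∂μ, lam ∈ uniformlyDiscrete d m r) (i j : Fin m) :
    (pairMoment μ i j).HasTemperateGrowth := by
  have := isLocallyFiniteMeasure_pairMoment hr hX i j
  obtain ⟨K, hK, h⟩ := exists_pairMoment_ball_le hr hX i j
  exact hasTemperateGrowth_of_ball_le (half_pos hr) hK h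

end Bounds

/-! ### Correlations of weighted counts -/

theorem integral_bind_kernel {α β E : Type*} [MeasurableSpace α] [MeasurableSpace β]
    [NormedAddCommGroup E] [NormedSpace ℝ E] {μ : Measure α} {κ : Kernel α β} {f : β → E}
    (hf : Integrable f (μ.bind κ)) :
    ∫ b, f b ∂(μ.bind κ) = ∫ a, ∫ b, f b ∂(κ a) ∂μ := by
  rw [Measure.comp_eq_comp_const_apply] at hf ⊢
  rw [Kernel.integral_comp hf, Kernel.const_apply]

theorem integrable_integral_of_bind {α β E : Type*} [MeasurableSpace α] [MeasurableSpace β]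
    [NormedAddCommGroup E] [NormedSpace ℝ E] {μ : Measure α} {κ : Kernel α β} {f : β → E}
    (hf : Integrable f (μ.bind κ)) : Integrable (fun a => ∫ b, f b ∂(κ a)) μ := by
  rw [Measure.comp_eq_comp_const_apply] at hf
  simpa using hf.integral_comp

section Pairs

variable {d m : ℕ} {r : ℝ} {μ : Measure (PointMeasure d m)}

/-- The measure of pairs of points of colours `i` and `j`. -/
def pairMeasure (μ : Measure (PointMeasure d m)) (i j : Fin m) : Measure (Space d × Space d) :=
  μ.bind (colourKernel d m i ×ₖ colourKernel d m j)

theorem lintegral_pairMeasure (μ : Measure (PointMeasure d m)) (i j : Fin m)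
    {H : Space d × Space d → ℝ≥0∞} (hH : Measurable H) :
    ∫⁻ p, H p ∂(pairMeasure μ i j) =
      ∫⁻ lam, ∫⁻ x, ∫⁻ y, H (x, y) ∂(lam.colour j) ∂(lam.colour i) ∂μ := by
  rw [pairMeasure, Measure.lintegral_bind (Kernel.aemeasurable _) hH.aemeasurable]
  refine lintegral_congr fun lam => ?_
  rw [Kernel.prod_apply, lintegral_prod _ hH.aemeasurable]
  rfl

theorem integral_conj_mul_colour (lam : PointMeasure d m) (i j : Fin m) (g f : Space d → ℂ) :
    ∫ p, starRingEnd ℂ (g p.1) * f p.2 ∂((colourKernel d m i ×ₖ colourKernel d m j) lam) =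
      starRingEnd ℂ (∫ x, g x ∂(lam.colour i)) * ∫ y, f y ∂(lam.colour j) := by
  rw [Kernel.prod_apply, integral_prod_mul (fun x => starRingEnd ℂ (g x)) f, integral_conj]
  rfl

theorem map_pairMeasure (μ : Measure (PointMeasure d m)) [SFinite μ]
    [VAddInvariantMeasure (Space d) (PointMeasure d m) μ] (i j : Fin m)
    [SFinite (pairMoment μ i j)] :
    (pairMeasure μ i j).map (fun p => (p.1, p.2 - p.1)) = volume.prod (pairMoment μ i j) := by
  have hdiff : Measurable fun p : Space d × Space d => (p.1, p.2 - p.1) := by fun_prop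
  ext A hA
  have hind : Measurable (A.indicator (1 : Space d × Space d → ℝ≥0∞)) := measurable_one.indicator hA
  rw [← lintegral_indicator_one hA, lintegral_map hind hdiff,
    lintegral_pairMeasure μ i j (H := fun p => A.indicator 1 (p.1, p.2 - p.1)) (hind.comp hdiff),
    lintegral_lintegral_lintegral_colour μ i j (F := fun a z => A.indicator 1 (a, z)) hind,
    ← lintegral_indicator_one hA, lintegral_prod_symm _ hind.aemeasurable]

variable [IsFiniteMeasure μ]

theorem integrable_pairMeasure (hr : 0 < r) (hX : ∀ᵐ lam ∂μ, lam ∈ uniformlyDiscrete d m r)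
    (i j : Fin m) (g f : 𝓢(Space d, ℂ)) :
    Integrable (fun p => starRingEnd ℂ (g p.1) * f p.2) (pairMeasure μ i j) := by
  have hcont : Continuous fun p : Space d × Space d => starRingEnd ℂ (g p.1) * f p.2 := by fun_prop
  refine ⟨hcont.aestronglyMeasurable, ?_⟩
  obtain ⟨Cg, hCg, hg⟩ := exists_lintegral_colour_schwartz_le m hr g
  obtain ⟨Cf, hCf, hf⟩ := exists_lintegral_colour_schwartz_le m hr f
  rw [HasFiniteIntegral, lintegral_pairMeasure μ i j hcont.measurable.enorm]
  calc ∫⁻ lam, ∫⁻ x, ∫⁻ y, ‖starRingEnd ℂ (g x) * f y‖ₑ ∂(lam.colour j) ∂(lam.colour i) ∂μ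
      ≤ ∫⁻ _, Cg * Cf ∂μ := by
        refine lintegral_mono_ae ?_
        filter_upwards [hX] with lam hlam
        simp_rw [enorm_mul, RCLike.enorm_conj]
        rw [lintegral_lintegral_mul g.continuous.measurable.enorm.aemeasurable
          f.continuous.measurable.enorm.aemeasurable]
        exact mul_le_mul' (hg lam hlam i) (hf lam hlam j)
    _ < ∞ := by
        rw [lintegral_const]
        exact ENNReal.mul_lt_top (ENNReal.mul_lt_top hCg.lt_top hCf.lt_top) (measure_lt_top μ _)

theorem integrable_conj_integral_mul_integral (hr : 0 < r)
    (hX : ∀ᵐ lam ∂μ, lam ∈ uniformlyDiscrete d m r) (i j : Fin m) (g f : 𝓢(Space d, ℂ)) :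
    Integrable (fun lam : PointMeasure d m =>
      starRingEnd ℂ (∫ x, g x ∂(lam.colour i)) * ∫ y, f y ∂(lam.colour j)) μ := by
  simpa only [integral_conj_mul_colour] using
    integrable_integral_of_bind (integrable_pairMeasure hr hX i j g f)

theorem integral_conj_integral_mul_integral
    [VAddInvariantMeasure (Space d) (PointMeasure d m) μ] (hr : 0 < r)
    (hX : ∀ᵐ lam ∂μ, lam ∈ uniformlyDiscrete d m r) (i j : Fin m) (g f : 𝓢(Space d, ℂ)) :
    ∫ lam, starRingEnd ℂ (∫ x, g x ∂(lam.colour i)) * ∫ y, f y ∂(lam.colour j) ∂μ =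
      ∫ z, (∫ a, starRingEnd ℂ (g a) * f (a + z)) ∂(pairMoment μ i j) := by
  have := isLocallyFiniteMeasure_pairMoment hr hX i j
  have hdiff : Measurable fun p : Space d × Space d => (p.1, p.2 - p.1) := by fun_prop
  have hint := integrable_pairMeasure hr hX i j g f
  let H : Space d × Space d → ℂ := fun q => starRingEnd ℂ (g q.1) * f (q.1 + q.2)
  have hH : Continuous H := by fun_prop
  have hHdiff (p : Space d × Space d) : H (p.1, p.2 - p.1) = starRingEnd ℂ (g p.1) * f p.2 := by
    simp only [H, add_sub_cancel]
  have hHint : Integrable H (volume.prod (pairMoment μ i j)) := by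
    rw [← map_pairMeasure μ i j, integrable_map_measure hH.aestronglyMeasurable hdiff.aemeasurable]
    simpa only [Function.comp_def, hHdiff] using hint
  calc ∫ lam, starRingEnd ℂ (∫ x, g x ∂(lam.colour i)) * ∫ y, f y ∂(lam.colour j) ∂μ
      = ∫ p, starRingEnd ℂ (g p.1) * f p.2 ∂(pairMeasure μ i j) := by
        simp_rw [← integral_conj_mul_colour]
        exact (integral_bind_kernel hint).symm
    _ = ∫ q, H q ∂((pairMeasure μ i j).map (fun p => (p.1, p.2 - p.1))) := by
        rw [integral_map hdiff.aemeasurable hH.aestronglyMeasurable]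
        simp only [hHdiff]
    _ = ∫ z, (∫ a, starRingEnd ℂ (g a) * f (a + z)) ∂(pairMoment μ i j) := by
        rw [map_pairMeasure μ i j, integral_prod_symm _ hHint]

end Pairs

section Covariance

variable {d m : ℕ} {r : ℝ} {μ : Measure (PointMeasure d m)}

/-- The weighted first moment of the weighted Palm measure, composed with the Fourier transform, as
a tempered distribution. -/
def spectralFunctional (μ : Measure (PointMeasure d m)) (w : Fin m → ℝ)
    [∀ i j, (pairMoment μ i j).HasTemperateGrowth] : 𝓢(Space d, ℂ) →L[ℂ] ℂ :=
  ∑ i, ∑ j, ((w i : ℂ) * (w j : ℂ)) • (SchwartzMap.integralCLM ℂ (pairMoment μ i j) ∘L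
    FourierTransform.fourierCLM ℂ 𝓢(Space d, ℂ))

theorem spectralFunctional_eq_sum (w : Fin m → ℝ)
    [∀ i j, (pairMoment μ i j).HasTemperateGrowth] (f : 𝓢(Space d, ℂ)) :
    spectralFunctional μ w f =
      ∑ i, ∑ j, (w i : ℂ) * ((w j : ℂ) * ∫ z, 𝓕 f z ∂(pairMoment μ i j)) := by
  simp only [spectralFunctional, sum_apply, smul_apply, ContinuousLinearMap.comp_apply,
    FourierTransform.fourierCLM_apply, SchwartzMap.integralCLM_apply, smul_eq_mul, mul_assoc]

theorem spectralFunctional_apply (w : Fin m → ℝ) [∀ i j, (pairMoment μ i j).HasTemperateGrowth]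
    (f : 𝓢(Space d, ℂ)) :
    spectralFunctional μ w f = weightedFirstMoment μ w (𝓕 f : 𝓢(Space d, ℂ)) := by
  have hint (i j : Fin m) : Integrable (𝓕 f : 𝓢(Space d, ℂ))
      ((palm μ i).bind (colourKernel d m j)) :=
    (𝓕 f : 𝓢(Space d, ℂ)).integrable (μ := pairMoment μ i j)
  have hint' (i j : Fin m) : Integrable (fun lam : PointMeasure d m => ∫ x, 𝓕 f x ∂(lam.colour j))
      (palm μ i) := integrable_integral_of_bind (hint i j)
  rw [spectralFunctional_eq_sum, weightedFirstMoment, weightedPalmIntegral]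
  refine Finset.sum_congr rfl fun i _ => ?_
  unfold weightedCount
  rw [← Finset.mul_sum, integral_finsetSum _ fun j _ => (hint' i j).const_mul _]
  refine congrArg _ (Finset.sum_congr rfl fun j _ => ?_)
  rw [integral_const_mul, pairMoment, integral_bind_kernel (hint i j)]
  rfl

/-- The weighted count of the Fourier transform of a Schwartz function. -/
def fourierCount (w : Fin m → ℝ) (f : 𝓢(Space d, ℂ)) : PointMeasure d m → ℂ :=
  weightedCount w (𝓕 f : 𝓢(Space d, ℂ))

theorem measurable_fourierCount (w : Fin m → ℝ) (f : 𝓢(Space d, ℂ)) :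
    Measurable (fourierCount w f : PointMeasure d m → ℂ) := by
  have h (j : Fin m) :
      StronglyMeasurable fun lam : PointMeasure d m => ∫ x, 𝓕 f x ∂(lam.colour j) :=
    StronglyMeasurable.integral_kernel (κ := colourKernel d m j)
      (𝓕 f : 𝓢(Space d, ℂ)).continuous.stronglyMeasurable
  exact Finset.measurable_sum Finset.univ fun j _ => (h j).measurable.const_mul (w j : ℂ)

theorem exists_norm_fourierCount_le (hr : 0 < r) (w : Fin m → ℝ) (g : 𝓢(Space d, ℂ)) :
    ∃ C : ℝ, ∀ lam ∈ uniformlyDiscrete d m r, ∀ f : 𝓢(Space d, ℂ),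
      (∀ a, ‖𝓕 f a‖ = ‖𝓕 g a‖) → ‖fourierCount w f lam‖ ≤ C := by
  obtain ⟨C, -, h⟩ := exists_norm_weightedCount_le d hr w
  obtain ⟨B, hB, hg⟩ := exists_norm_le_mul_decayWeight (𝓕 g)
  exact ⟨B * C, fun lam hlam f hf => h lam hlam _ B hB fun x => (hf x).trans_le (hg x)⟩

theorem conj_weightedCount_mul_weightedCount (w : Fin m → ℝ) (g f : Space d → ℂ)
    (lam : PointMeasure d m) :
    starRingEnd ℂ (weightedCount w g lam) * weightedCount w f lam =
      ∑ i, ∑ j, (w i : ℂ) * ((w j : ℂ) *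
        (starRingEnd ℂ (∫ x, g x ∂(lam.colour i)) * ∫ y, f y ∂(lam.colour j))) := by
  rw [weightedCount, weightedCount, map_sum, Finset.sum_mul_sum]
  refine Finset.sum_congr rfl fun i _ => Finset.sum_congr rfl fun j _ => ?_
  rw [map_mul, Complex.conj_ofReal]
  ring

variable [IsFiniteMeasure μ] [VAddInvariantMeasure (Space d) (PointMeasure d m) μ]
  [∀ i j, (pairMoment μ i j).HasTemperateGrowth]

theorem integral_conj_fourierCount_mul_fourierCount (hr : 0 < r)
    (hX : ∀ᵐ lam ∂μ, lam ∈ uniformlyDiscrete d m r) (w : Fin m → ℝ) (g f : 𝓢(Space d, ℂ)) :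
    ∫ lam, starRingEnd ℂ (fourierCount w g lam) * fourierCount w f lam ∂μ =
      spectralFunctional μ w (conjMul g f) := by
  have hint (i j : Fin m) := ((integrable_conj_integral_mul_integral hr hX i j (𝓕 g)
    (𝓕 f)).const_mul (w j : ℂ)).const_mul (w i : ℂ)
  simp_rw [fourierCount, conj_weightedCount_mul_weightedCount]
  rw [spectralFunctional_eq_sum, integral_finsetSum _ fun i _ => integrable_finsetSum _
    fun j _ => hint i j]
  refine Finset.sum_congr rfl fun i _ => ?_
  rw [integral_finsetSum _ fun j _ => hint i j]
  refine Finset.sum_congr rfl fun j _ => ?_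
  rw [integral_const_mul, integral_const_mul, integral_conj_integral_mul_integral hr hX]
  simp_rw [integral_conj_fourier_mul_fourier]

open scoped ComplexOrder in
theorem isPositiveOnSquares_spectralFunctional (hr : 0 < r)
    (hX : ∀ᵐ lam ∂μ, lam ∈ uniformlyDiscrete d m r) (w : Fin m → ℝ) :
    IsPositiveOnSquares (spectralFunctional μ w) := fun g => by
  rw [← integral_conj_fourierCount_mul_fourierCount hr hX]
  exact integral_nonneg fun lam => star_mul_self_nonneg _

theorem exists_norm_spectralFunctional_conjMul_le (hr : 0 < r)
    (hX : ∀ᵐ lam ∂μ, lam ∈ uniformlyDiscrete d m r) (w : Fin m → ℝ) (g : 𝓢(Space d, ℂ)) :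
    ∃ C : ℝ, ∀ k, ‖spectralFunctional μ w
      (conjMul (g.compSubConstCLM ℂ k) (g.compSubConstCLM ℂ k))‖ ≤ C := by
  obtain ⟨C, hC⟩ := exists_norm_fourierCount_le hr w g
  refine ⟨C * C * μ.real univ, fun k => ?_⟩
  rw [← integral_conj_fourierCount_mul_fourierCount hr hX]
  refine norm_integral_le_of_norm_le_const ?_
  filter_upwards [hX] with lam hlam
  have hk := hC lam hlam (g.compSubConstCLM ℂ k) fun a => by
    rw [fourier_compSubConstCLM, norm_mul, norm_character, one_mul]
  rw [norm_mul, RCLike.norm_conj]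
  exact mul_le_mul hk hk (norm_nonneg _) ((norm_nonneg _).trans hk)

end Covariance

/-! ### The diffraction measure -/

section Diffraction

variable {d m : ℕ} {r : ℝ} {μ : Measure (PointMeasure d m)} {w : Fin m → ℝ}
  {ν ν₁ ν₂ : Measure (Space d)}

theorem IsDiffraction.unique (h₁ : IsDiffraction μ w ν₁) (h₂ : IsDiffraction μ w ν₂) :
    ν₁ = ν₂ := by
  have := h₁.locallyFinite
  have := h₂.locallyFinite
  exact ext_of_integral_schwartz fun f => (h₁.integral_eq f).trans (h₂.integral_eq f).symm

variable [IsFiniteMeasure μ] [VAddInvariantMeasure (Space d) (PointMeasure d m) μ]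

theorem exists_isDiffraction (hr : 0 < r) (hX : ∀ᵐ lam ∂μ, lam ∈ uniformlyDiscrete d m r)
    (w : Fin m → ℝ) :
    ∃ ν : Measure (Space d), IsDiffraction μ w ν ∧ ν.HasTemperateGrowth := by
  have := hasTemperateGrowth_pairMoment hr hX
  obtain ⟨ν, hν, htg, hint⟩ :=
    (isPositiveOnSquares_spectralFunctional hr hX w).exists_hasTemperateGrowth_measure
      (exists_norm_spectralFunctional_conjMul_le hr hX w)
  refine ⟨ν, ⟨hν, fun f => f.integrable, fun f => ?_⟩, htg⟩
  rw [hint, spectralFunctional_apply, SchwartzMap.fourier_coe]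

theorem IsDiffraction.hasTemperateGrowth (hr : 0 < r)
    (hX : ∀ᵐ lam ∂μ, lam ∈ uniformlyDiscrete d m r) (hν : IsDiffraction μ w ν) :
    ν.HasTemperateGrowth := by
  obtain ⟨ν', hν', htg⟩ := exists_isDiffraction hr hX w
  rwa [hν.unique hν']

theorem existsUnique_isDiffraction (hr : 0 < r)
    (hX : ∀ᵐ lam ∂μ, lam ∈ uniformlyDiscrete d m r) (w : Fin m → ℝ) :
    ∃! ν : Measure (Space d), IsDiffraction μ w ν := by
  obtain ⟨ν, hν, -⟩ := exists_isDiffraction hr hX w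
  exact ⟨ν, hν, fun ν' hν' => hν'.unique hν⟩

theorem IsDiffraction.integral_conj_mul (hr : 0 < r)
    (hX : ∀ᵐ lam ∂μ, lam ∈ uniformlyDiscrete d m r) (hν : IsDiffraction μ w ν)
    (g f : 𝓢(Space d, ℂ)) :
    ∫ lam, starRingEnd ℂ (fourierCount w g lam) * fourierCount w f lam ∂μ =
      ∫ k, starRingEnd ℂ (g k) * f k ∂ν := by
  have := hasTemperateGrowth_pairMoment hr hX
  rw [integral_conj_fourierCount_mul_fourierCount hr hX, spectralFunctional_apply,
    SchwartzMap.fourier_coe, ← hν.integral_eq]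
  simp only [conjMul_apply]

end Diffraction

/-! ### The diffraction isometry -/

section Isometry

variable {d m : ℕ} {r : ℝ} {μ : Measure (PointMeasure d m)} {w : Fin m → ℝ}

theorem integral_colour_vadd (t : Space d) (lam : PointMeasure d m) (j : Fin m) (f : Space d → ℂ) :
    ∫ x, f x ∂((t +ᵥ lam).colour j) = ∫ x, f (t + x) ∂(lam.colour j) := by
  rw [PointMeasure.colour_vadd]
  exact (measurableEmbedding_addLeft t).integral_map f

theorem fourierCount_modulate (w : Fin m → ℝ) (t : Space d) (f : 𝓢(Space d, ℂ))
    (lam : PointMeasure d m) :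
    fourierCount w (modulate t f) lam = fourierCount w f (-t +ᵥ lam) := by
  simp only [fourierCount, weightedCount, integral_colour_vadd, fourier_modulate, neg_add_eq_sub]

variable [IsFiniteMeasure μ]

theorem memLp_fourierCount (hr : 0 < r) (hX : ∀ᵐ lam ∂μ, lam ∈ uniformlyDiscrete d m r)
    (w : Fin m → ℝ) (f : 𝓢(Space d, ℂ)) {p : ℝ≥0∞} : MemLp (fourierCount w f) p μ := by
  obtain ⟨C, hC⟩ := exists_norm_fourierCount_le hr w f
  refine MemLp.of_bound (measurable_fourierCount w f).aestronglyMeasurable C ?_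
  filter_upwards [hX] with lam hlam
  exact hC lam hlam f fun _ => rfl

/-- The linear map sending a Schwartz function to the weighted count of its Fourier transform, as
an element of `L²`. -/
def fourierCountLp (hr : 0 < r) (hX : ∀ᵐ lam ∂μ, lam ∈ uniformlyDiscrete d m r)
    (w : Fin m → ℝ) : 𝓢(Space d, ℂ) →ₗ[ℂ] Lp ℂ 2 μ where
  toFun f := (memLp_fourierCount hr hX w f).toLp _
  map_add' f g := by
    rw [← MemLp.toLp_add, MemLp.toLp_eq_toLp_iff]
    filter_upwards [hX] with lam hlam
    simp only [fourierCount, weightedCount, Pi.add_apply, ← Finset.sum_add_distrib, ← mul_add,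
      FourierTransform.fourier_add, add_apply,
      integral_add (integrable_colour hr hlam _ (𝓕 f)) (integrable_colour hr hlam _ (𝓕 g))]
  map_smul' c f := by
    rw [RingHom.id_apply, ← MemLp.toLp_const_smul, MemLp.toLp_eq_toLp_iff]
    refine ae_of_all _ fun lam => ?_
    simp only [fourierCount, weightedCount, Pi.smul_apply, smul_eq_mul, Finset.mul_sum,
      FourierTransform.fourier_smul, smul_apply, integral_const_mul, mul_left_comm c]

theorem coeFn_fourierCountLp (hr : 0 < r) (hX : ∀ᵐ lam ∂μ, lam ∈ uniformlyDiscrete d m r)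
    (w : Fin m → ℝ) (f : 𝓢(Space d, ℂ)) :
    fourierCountLp hr hX w f =ᵐ[μ] fourierCount w f :=
  (memLp_fourierCount hr hX w f).coeFn_toLp

theorem mulCharacter_toLp {V : Type*} [NormedAddCommGroup V] [InnerProductSpace ℝ V]
    [MeasurableSpace V] [BorelSpace V] (ν : Measure V)
    [ν.HasTemperateGrowth] (t : V) (f : 𝓢(V, ℂ)) :
    mulCharacter ν t (f.toLp 2 ν) = (modulate t f).toLp 2 ν := by
  refine Lp.ext ?_
  filter_upwards [coeFn_mulCharacter t (f.toLp 2 ν), f.coeFn_toLp 2 ν,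
    (modulate t f).coeFn_toLp 2 ν] with k h₁ h₂ h₃
  rw [h₁, h₂, h₃, modulate_apply]

variable [VAddInvariantMeasure (Space d) (PointMeasure d m) μ]

theorem koopman_fourierCountLp (hr : 0 < r) (hX : ∀ᵐ lam ∂μ, lam ∈ uniformlyDiscrete d m r)
    (w : Fin m → ℝ) (t : Space d) (f : 𝓢(Space d, ℂ)) :
    koopman (Space d) μ t (fourierCountLp hr hX w f) = fourierCountLp hr hX w (modulate t f) :=
  (koopman_eq_iff t (coeFn_fourierCountLp hr hX w f)
    (coeFn_fourierCountLp hr hX w (modulate t f))).2 <|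
    ae_of_all _ fun lam => (fourierCount_modulate w t f lam).symm

variable {ν : Measure (Space d)} [ν.HasTemperateGrowth]

theorem IsDiffraction.norm_fourierCountLp (hr : 0 < r)
    (hX : ∀ᵐ lam ∂μ, lam ∈ uniformlyDiscrete d m r) (hν : IsDiffraction μ w ν)
    (f : 𝓢(Space d, ℂ)) : ‖fourierCountLp hr hX w f‖ = ‖f.toLp 2 ν‖ := by
  have hinner : inner ℂ (fourierCountLp hr hX w f) (fourierCountLp hr hX w f) =
      inner ℂ (f.toLp 2 ν) (f.toLp 2 ν) := by
    rw [SchwartzMap.inner_toL2_toL2_eq f f ν, L2.inner_def]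
    simp only [RCLike.inner_apply']
    rw [← hν.integral_conj_mul hr hX]
    refine integral_congr_ae ?_
    filter_upwards [coeFn_fourierCountLp hr hX w f] with lam hlam
    rw [hlam]
  rw [norm_eq_sqrt_re_inner (𝕜 := ℂ), hinner, ← norm_eq_sqrt_re_inner]

theorem IsDiffraction.exists_isometry (hr : 0 < r)
    (hX : ∀ᵐ lam ∂μ, lam ∈ uniformlyDiscrete d m r) (hν : IsDiffraction μ w ν) :
    ∃ θ : Lp ℂ 2 ν →ₗᵢ[ℂ] Lp ℂ 2 μ, (∀ f, θ (f.toLp 2 ν) = fourierCountLp hr hX w f) ∧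
      ∀ t u, koopman (Space d) μ t (θ u) = θ (mulCharacter ν t u) := by
  have := hν.locallyFinite
  let e : 𝓢(Space d, ℂ) →ₗ[ℂ] Lp ℂ 2 ν := (SchwartzMap.toLpCLM ℂ ℂ 2 ν).toLinearMap
  have hdense : DenseRange e := SchwartzMap.denseRange_toLpCLM (F := ℂ) (by simp)
  let T := (fourierCountLp hr hX w).extendOfNorm e
  have hT (f : 𝓢(Space d, ℂ)) : T (e f) = fourierCountLp hr hX w f :=
    LinearMap.extendOfNorm_eq hdense
      ⟨1, fun f => (hν.norm_fourierCountLp hr hX f).le.trans_eq (one_mul _).symm⟩ f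
  refine ⟨⟨T.toLinearMap, fun u => ?_⟩, hT, fun t u => ?_⟩
  · refine hdense.induction_on (p := fun u => ‖T u‖ = ‖u‖) u
      (isClosed_eq (by fun_prop) (by fun_prop)) fun f => ?_
    rw [hT]
    exact hν.norm_fourierCountLp hr hX f
  · refine hdense.induction_on
      (p := fun u => koopman (Space d) μ t (T u) = T (mulCharacter ν t u)) u
      (isClosed_eq (by fun_prop) (by fun_prop)) fun f => ?_
    rw [hT, koopman_fourierCountLp, ← hT]
    exact congrArg T (mulCharacter_toLp ν t f).symm

end Isometry

/-! ### Counting points in small sets -/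

section LocalCounts

theorem measurable_of_measurable_coe_isOpen_subset {α X : Type*} [MeasurableSpace α]
    [TopologicalSpace X] [MeasurableSpace X] [BorelSpace X] {ν : α → Measure X} {B : ℕ → Set X}
    (hB : ∀ n, IsOpen (B n)) (hBu : ⋃ n, B n = univ) (hfin : ∀ a n, ν a (B n) ≠ ∞)
    (h : ∀ n U, IsOpen U → U ⊆ B n → Measurable fun a => ν a U) : Measurable ν := by
  have hBm (n : ℕ) : MeasurableSet (B n) := (hB n).measurableSet
  have hres (n : ℕ) : Measurable fun a => (ν a).restrict (B n) := by
    have (a : α) : IsFiniteMeasure ((ν a).restrict (B n)) := isFiniteMeasure_restrict.2 (hfin a n)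
    refine Measurable.measure_of_isPiSystem BorelSpace.measurable_eq isPiSystem_isOpen
      (fun U hU => ?_) ?_
    · simp only [Measure.restrict_apply' (hBm n)]
      exact h n _ (hU.inter (hB n)) inter_subset_right
    · simp only [Measure.restrict_apply_univ]
      exact h n _ (hB n) subset_rfl
  refine Measure.measurable_of_measurable_coe _ fun A hA => ?_
  have hpiece (n : ℕ) : MeasurableSet (A ∩ disjointed B n) := hA.inter (.disjointed hBm n)
  have hsum (a : α) : ν a A = ∑' n, (ν a).restrict (B n) (A ∩ disjointed B n) := by
    have hn (n : ℕ) : (ν a).restrict (B n) (A ∩ disjointed B n) = ν a (A ∩ disjointed B n) :=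
      Measure.restrict_eq_self _ (inter_subset_right.trans (disjointed_subset B n))
    simp only [hn]
    rw [← measure_iUnion (fun n k hnk => (disjoint_disjointed B hnk).mono inter_subset_right
      inter_subset_right) hpiece, ← inter_iUnion, iUnion_disjointed, hBu, inter_univ]
  simp only [hsum]
  exact Measurable.tsum fun n => (Measure.measurable_coe (hpiece n)).comp (hres n)

variable {d m : ℕ} {r : ℝ}

theorem measurable_of_measurable_colour_subset_ball {α : Type*} [MeasurableSpace α]
    {g : α → PointMeasure d m} {ε : ℝ} (hε : 0 < ε)
    (h : ∀ (i : Fin m) (U : Set (Space d)) (a : Space d), IsOpen U → U ⊆ Metric.ball a ε →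
      Measurable fun x => (g x).colour i U) : Measurable g := by
  have hunion : ⋃ n, Metric.ball (TopologicalSpace.denseSeq (Space d) n) ε = univ :=
    eq_univ_of_forall fun x => mem_iUnion.2
      ((TopologicalSpace.denseRange_denseSeq (Space d)).exists_dist_lt x hε)
  exact measurable_of_measurable_colour fun i => measurable_of_measurable_coe_isOpen_subset
    (fun _ => Metric.isOpen_ball) hunion (fun _ _ => measure_ball_lt_top.ne)
    fun n U hU hUn => h i U _ hU hUn

theorem PointMeasure.exists_colour_eq_natCast (lam : PointMeasure d m) (i : Fin m)
    {U : Set (Space d)} (hU : MeasurableSet U) (hUb : Bornology.IsBounded U) :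
    ∃ n : ℕ, lam.colour i U = n := by
  rw [PointMeasure.colour_apply]
  refine lam.exists_nat _ (hU.prod (measurableSet_singleton i)) ?_
  rw [closure_prod_eq, closure_singleton]
  exact hUb.isCompact_closure.prod isCompact_singleton

theorem exists_colour_eq_ite {lam : PointMeasure d m} (h : lam ∈ uniformlyDiscrete d m r)
    {U : Set (Space d)} {a : Space d} (hU : MeasurableSet U) (hUa : U ⊆ Metric.ball a (r / 2)) :
    ∃ o : Option (Fin m), ∀ i, lam.colour i U = if o = some i then 1 else 0 := by
  choose n hn using fun i =>
    lam.exists_colour_eq_natCast i hU (Metric.isBounded_ball.subset hUa)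
  have hsum : ∑ i, n i ≤ 1 := by
    have := (Finset.sum_le_sum fun i _ => measure_mono (μ := lam.colour i) hUa).trans
      (sum_colour_ball_le h a)
    simp only [hn] at this
    exact_mod_cast this
  simp only [hn]
  rw [Finset.sum_le_one_iff] at hsum
  by_cases! hzero : ∀ i, n i = 0
  · exact ⟨none, fun i => by simp [hzero]⟩
  · obtain ⟨i₀, hi₀⟩ := hzero
    refine ⟨some i₀, fun i => ?_⟩
    have hi := hsum i₀ i (Finset.mem_univ _) (Finset.mem_univ _) hi₀
    split_ifs with h
    · obtain rfl := Option.some_injective _ h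
      rw [(hi hi₀).2, Nat.cast_one]
    · rw [not_imp_comm.1 hi (fun h' => h (congrArg some h'.1)), Nat.cast_zero]

open scoped ContDiff in
theorem exists_schwartzMap_tendsto_indicator {E : Type*} [NormedAddCommGroup E] [NormedSpace ℝ E]
    [FiniteDimensional ℝ E] {U : Set E} (hU : IsOpen U) (hb : Bornology.IsBounded U) :
    ∃ f : ℕ → 𝓢(E, ℂ), (∀ n x, ‖f n x‖ ≤ U.indicator 1 x) ∧
      ∀ x, Tendsto (fun n => f n x) atTop (𝓝 (U.indicator 1 x)) := by
  obtain ⟨f, hfU, hfs, hf01⟩ := hU.exists_contDiff_support_eq (n := ⊤)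
  have hf0 (x : E) : 0 ≤ f x := (hf01 (mem_range_self x)).1
  have hf1 (x : E) : 0 ≤ 1 - f x := sub_nonneg.2 (hf01 (mem_range_self x)).2
  let φ (n : ℕ) (x : E) : ℂ := (1 - (1 - f x) ^ n : ℝ)
  have hφ0 (n : ℕ) (x : E) (hx : x ∉ U) : φ n x = 0 := by
    have : f x = 0 := by rwa [← hfU, Function.notMem_support] at hx
    simp [φ, this]
  have hφc (n : ℕ) : HasCompactSupport (φ n) :=
    .of_support_subset_isCompact hb.isCompact_closure fun x hx =>
      subset_closure (not_not.1 fun hxU => hx (hφ0 n x hxU))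
  have hφs (n : ℕ) : ContDiff ℝ ∞ (φ n) :=
    Complex.ofRealCLM.contDiff.comp (contDiff_const.sub ((contDiff_const.sub hfs).pow n))
  refine ⟨fun n => (hφc n).toSchwartzMap (hφs n), fun n x => ?_, fun x => ?_⟩
  · change ‖φ n x‖ ≤ _
    by_cases hx : x ∈ U
    · have hpow : (1 - f x) ^ n ≤ 1 := pow_le_one₀ (hf1 x) (by linarith [hf0 x])
      rw [indicator_of_mem hx, Complex.norm_real, Real.norm_of_nonneg (sub_nonneg.2 hpow)]
      simpa using pow_nonneg (hf1 x) n
    · rw [indicator_of_notMem hx, hφ0 n x hx, norm_zero]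
  · change Tendsto (fun n => φ n x) atTop _
    by_cases hx : x ∈ U
    · have hpos : 0 < f x := (hf0 x).lt_of_ne' (by rwa [← hfU] at hx)
      have hlim := (tendsto_pow_atTop_nhds_zero_of_lt_one (hf1 x) (by linarith)).const_sub 1
      rw [sub_zero] at hlim
      rw [indicator_of_mem hx]
      exact (Complex.continuous_ofReal.tendsto' _ _ Complex.ofReal_one).comp hlim
    · rw [indicator_of_notMem hx]
      exact tendsto_const_nhds.congr fun n => (hφ0 n x hx).symm

end LocalCounts

/-! ### Pure point spectrum -/

section PurePointSpectrum

variable {d m : ℕ} {r : ℝ} {μ : Measure (PointMeasure d m)}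

theorem isEigenfunction_iff [VAddInvariantMeasure (Space d) (PointMeasure d m) μ]
    {F : Lp ℂ 2 μ} :
    IsEigenfunction μ F ↔ F ≠ 0 ∧ ∃ k, F ∈ jointEigenspace (koopman (Space d) μ) k := by
  simp only [IsEigenfunction, mem_jointEigenspace_koopman (.refl _ F), character_eq_exp]

theorem hasPurePointSpectrum_iff [VAddInvariantMeasure (Space d) (PointMeasure d m) μ] :
    HasPurePointSpectrum μ ↔ purePointSubspace (koopman (Space d) μ) = ⊤ := by
  have hspan : Submodule.span ℂ {F : Lp ℂ 2 μ | IsEigenfunction μ F} =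
      ⨆ k, jointEigenspace (koopman (Space d) μ) k := by
    refine le_antisymm (Submodule.span_le.2 fun F hF => ?_) (iSup_le fun k F hF => ?_)
    · obtain ⟨-, k, hk⟩ := isEigenfunction_iff.1 hF
      exact Submodule.mem_iSup_of_mem k hk
    · rcases eq_or_ne F 0 with rfl | hF0
      · exact zero_mem _
      · exact Submodule.subset_span (isEigenfunction_iff.2 ⟨hF0, k, hF⟩)
  rw [HasPurePointSpectrum, Submodule.dense_iff_topologicalClosure_eq_top, hspan]
  rfl

variable [IsFiniteMeasure μ] [VAddInvariantMeasure (Space d) (PointMeasure d m) μ]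
  {w : Fin m → ℝ} {U : Set (Space d)} {a : Space d}

theorem isAlmostPeriodic_weightedCount (hr : 0 < r)
    (hX : ∀ᵐ lam ∂μ, lam ∈ uniformlyDiscrete d m r)
    (hE : ∀ f, fourierCountLp hr hX w f ∈ purePointSubspace (koopman (Space d) μ))
    (f : 𝓢(Space d, ℂ)) : IsAlmostPeriodic (Space d) μ (weightedCount w f) := by
  have hf : fourierCount w (𝓕⁻ f) = (weightedCount w f : PointMeasure d m → ℂ) := by
    rw [fourierCount, FourierTransform.fourier_fourierInv_eq]
  rw [← hf]
  exact ⟨memLp_fourierCount hr hX w _, _, hE (𝓕⁻ f), coeFn_fourierCountLp hr hX w _⟩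

theorem isAlmostPeriodic_weightedCount_indicator (hr : 0 < r)
    (hX : ∀ᵐ lam ∂μ, lam ∈ uniformlyDiscrete d m r)
    (hE : ∀ f, fourierCountLp hr hX w f ∈ purePointSubspace (koopman (Space d) μ))
    (hU : IsOpen U) (hUa : U ⊆ Metric.ball a (r / 2)) :
    IsAlmostPeriodic (Space d) μ (weightedCount w (U.indicator 1)) := by
  obtain ⟨f, hf, hlim⟩ :=
    exists_schwartzMap_tendsto_indicator hU (Metric.isBounded_ball.subset hUa)
  have hint (lam : PointMeasure d m) (j : Fin m) :
      Integrable (U.indicator (1 : Space d → ℝ)) (lam.colour j) :=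
    (integrable_indicator_iff hU.measurableSet).2 (integrableOn_const
      (measure_ne_top_of_subset hUa measure_ball_lt_top.ne))
  refine IsAlmostPeriodic.of_tendsto (C := ∑ j, |w j|)
    (fun n => isAlmostPeriodic_weightedCount hr hX hE (f n)) (fun n => ?_)
    (ae_of_all _ fun lam => tendsto_finsetSum _ fun j _ => Tendsto.const_mul _ ?_)
  · filter_upwards [hX] with lam hlam
    refine norm_sum_le_of_le _ fun j _ => ?_
    rw [norm_mul, Complex.norm_real, Real.norm_eq_abs]
    refine mul_le_of_le_one_right (abs_nonneg _) ?_
    calc ‖∫ x, f n x ∂(lam.colour j)‖ ≤ ∫ x, U.indicator 1 x ∂(lam.colour j) :=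
          norm_integral_le_of_norm_le (hint lam j) (ae_of_all _ (hf n))
      _ = (lam.colour j).real U := integral_indicator_one hU.measurableSet
      _ ≤ 1 := ENNReal.toReal_le_of_le_ofReal zero_le_one
          (by simpa using (measure_mono hUa).trans (colour_ball_le hlam j a))
  · exact tendsto_integral_of_dominated_convergence _
      (fun n => (f n).continuous.aestronglyMeasurable) (hint lam j)
      (fun n => ae_of_all _ (hf n)) (ae_of_all _ hlim)

theorem weightedCount_indicator_one {lam : PointMeasure d m} {o : Option (Fin m)}
    (hU : MeasurableSet U) (h : ∀ i, lam.colour i U = if o = some i then 1 else 0) :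
    weightedCount w (U.indicator 1) lam = o.elim 0 fun j => (w j : ℂ) := by
  have hcount (j : Fin m) : ∫ x, U.indicator (1 : Space d → ℂ) x ∂(lam.colour j) =
      if o = some j then 1 else 0 := by
    rw [integral_indicator hU]
    simp [Measure.real, h, apply_ite ENNReal.toReal]
  simp only [weightedCount, hcount]
  cases o <;> simp

/-- The weights are nonzero and distinct, so a polynomial in the weighted count tells whether there
is a point of colour `i`. -/
theorem isAlmostPeriodic_indicator_colour_eq_one (hr : 0 < r)
    (hX : ∀ᵐ lam ∂μ, lam ∈ uniformlyDiscrete d m r) (hw : Function.Injective w)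
    (hw0 : ∀ i, w i ≠ 0)
    (hE : ∀ f, fourierCountLp hr hX w f ∈ purePointSubspace (koopman (Space d) μ))
    (hU : IsOpen U) (hUa : U ⊆ Metric.ball a (r / 2)) (i : Fin m) :
    IsAlmostPeriodic (Space d) μ ({lam | lam.colour i U = 1}.indicator 1) := by
  let v (o : Option (Fin m)) : ℂ := o.elim 0 fun j => (w j : ℂ)
  have hv : Function.Injective v := by
    rintro (_ | j) (_ | k) h
    · rfl
    · exact absurd (Complex.ofReal_eq_zero.1 h.symm) (hw0 k)
    · exact absurd (Complex.ofReal_eq_zero.1 h) (hw0 j)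
    · exact congrArg some (hw (Complex.ofReal_injective h))
  have hp (o : Option (Fin m)) :
      (Lagrange.basis Finset.univ v (some i)).eval (v o) = if o = some i then 1 else 0 := by
    split_ifs with h
    · rw [h, Lagrange.eval_basis_self hv.injOn (Finset.mem_univ _)]
    · exact Lagrange.eval_basis_of_ne (Ne.symm h) (Finset.mem_univ _)
  refine ((isAlmostPeriodic_weightedCount_indicator hr hX hE hU hUa).polynomial_eval
    (Lagrange.basis Finset.univ v (some i))).congr ?_
  filter_upwards [hX] with lam hlam
  obtain ⟨o, ho⟩ := exists_colour_eq_ite hlam hU.measurableSet hUa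
  rw [weightedCount_indicator_one hU.measurableSet ho, hp, indicator_apply]
  simp [ho]

theorem measurable_sigmaAlgebra_colour (hr : 0 < r)
    (hX : ∀ᵐ lam ∂μ, lam ∈ uniformlyDiscrete d m r) (hw : Function.Injective w)
    (hw0 : ∀ i, w i ≠ 0)
    (hE : ∀ f, fourierCountLp hr hX w f ∈ purePointSubspace (koopman (Space d) μ))
    (hU : IsOpen U) (hUa : U ⊆ Metric.ball a (r / 2)) (i : Fin m) :
    Measurable[IsAlmostPeriodic.sigmaAlgebra (Space d) μ]
      fun lam : PointMeasure d m => lam.colour i U := by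
  have hmeas : Measurable[IsAlmostPeriodic.sigmaAlgebra (Space d) μ]
      ({lam : PointMeasure d m | lam.colour i U = 1}.indicator fun _ => (1 : ℝ≥0∞)) :=
    Measurable.indicator measurable_const
      (isAlmostPeriodic_indicator_colour_eq_one hr hX hw hw0 hE hU hUa i)
  refine IsAlmostPeriodic.measurable_congr hmeas ?_
  filter_upwards [hX] with lam hlam
  obtain ⟨o, ho⟩ := exists_colour_eq_ite hlam hU.measurableSet hUa
  simp [indicator_apply, ho]

theorem purePointSubspace_koopman_eq_top_of_fourierCountLp_mem (hr : 0 < r)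
    (hX : ∀ᵐ lam ∂μ, lam ∈ uniformlyDiscrete d m r) (hw : Function.Injective w)
    (hw0 : ∀ i, w i ≠ 0)
    (hE : ∀ f, fourierCountLp hr hX w f ∈ purePointSubspace (koopman (Space d) μ)) :
    purePointSubspace (koopman (Space d) μ) = ⊤ := by
  have hid : @Measurable _ _ (IsAlmostPeriodic.sigmaAlgebra (Space d) μ) _
      (id : PointMeasure d m → PointMeasure d m) :=
    @measurable_of_measurable_colour_subset_ball d m _
      (IsAlmostPeriodic.sigmaAlgebra (Space d) μ) id _ (half_pos hr)
      fun i _ _ hU hUa => measurable_sigmaAlgebra_colour hr hX hw hw0 hE hU hUa i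
  exact purePointSubspace_koopman_eq_top fun A hA => hid hA

theorem IsDiffraction.isPurePoint_iff (hr : 0 < r)
    (hX : ∀ᵐ lam ∂μ, lam ∈ uniformlyDiscrete d m r) (hw : Function.Injective w)
    (hw0 : ∀ i, w i ≠ 0) {ν : Measure (Space d)} (hν : IsDiffraction μ w ν) :
    IsPurePoint ν ↔ HasPurePointSpectrum μ := by
  have := hν.locallyFinite
  have := hν.hasTemperateGrowth hr hX
  obtain ⟨θ, hθ, hcomm⟩ := hν.exists_isometry hr hX
  rw [IsPurePoint, exists_countable_iff_purePointSubspace_mulCharacter_eq_top,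
    hasPurePointSpectrum_iff]
  refine ⟨fun h => purePointSubspace_koopman_eq_top_of_fourierCountLp_mem hr hX hw hw0 fun f => ?_,
    purePointSubspace_eq_top_of_isometry hcomm⟩
  rw [← hθ]
  exact apply_mem_purePointSubspace_of_isometry hcomm h _

end PurePointSpectrum

end PointProc

end

theorem mainTheorem6_general (d m : ℕ) (μ : Measure (PointProc.PointMeasure d m))
    [IsFiniteMeasure μ] [VAddInvariantMeasure (PointProc.Space d) (PointProc.PointMeasure d m) μ]
    (r : ℝ) (hr : 0 < r) (hX : ∀ᵐ lam ∂μ, lam ∈ PointProc.uniformlyDiscrete d m r)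
    (w : Fin m → ℝ) (hw : Function.Injective w) (hw0 : ∀ i, w i ≠ 0) :
    (∃! ν : Measure (PointProc.Space d), PointProc.IsDiffraction μ w ν) ∧
      ∀ ν : Measure (PointProc.Space d), PointProc.IsDiffraction μ w ν →
        (PointProc.IsPurePoint ν ↔ PointProc.HasPurePointSpectrum μ) :=
  ⟨PointProc.existsUnique_isDiffraction hr hX w, fun _ hν => hν.isPurePoint_iff hr hX hw hw0⟩

theorem mainTheorem6 (d m : ℕ) (μ : Measure (PointProc.PointMeasure d m))
    [IsProbabilityMeasure μ]
    (r : ℝ) (hr : 0 < r) (hX : μ.support ⊆ PointProc.uniformlyDiscrete d m r)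
    (hErg : ErgodicVAdd (PointProc.Space d) (PointProc.PointMeasure d m) μ)
    (hI : ∀ i, 0 < PointProc.intensity μ i)
    (w : Fin m → ℝ) (hw : Function.Injective w) (hw0 : ∀ i, w i ≠ 0) :
    (∃! ν : Measure (PointProc.Space d), PointProc.IsDiffraction μ w ν) ∧
      ∀ ν : Measure (PointProc.Space d), PointProc.IsDiffraction μ w ν →
        (PointProc.IsPurePoint ν ↔ PointProc.HasPurePointSpectrum μ) :=
  mainTheorem6_general d m μ r hr (PointProc.ae_mem_uniformlyDiscrete hX) w hw hw0
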